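/- Let $\mathbb F_q$ be a finite field, $\psi:\mathbb F_q\to\mathbb C^\times$ a nontrivial additive character, $n$ a natural number and $a\in M_n(\mathbb F_q)$ a matrix whose only eigenvalue in $\overline{\mathbb F}_q$ is $\alpha\in\mathbb F_q$. Let \[K(a)=\sum_{x\in \mathrm{GL}_n(\mathbb F_q)}\psi(\operatorname{tr}(ax+x^{-1})),\qquad K(\alpha,\mathbb F_{q^m})=\sum_{x\in\mathbb F_{q^m}^\times}\psi(\operatorname{Tr}_{\mathbb F_{q^m}|\mathbb F_q}(\alpha x+x^{-1})).\] There are complex numbers $\lambda,\bar\lambda$, the Frobenius eigenvalues of the classical Kloosterman sum $K(\alpha)$, such that $K(\alpha,\mathbb F_{q^m})=-(\lambda^m+\bar\lambda^m)$ for all $m\ge 1$ (this determines the unordered pair; for $\alpha=0$ it is $\{1,0\}$). For them, with the convention $0^0=1$, \[K(a)=(-1)^nq^{n(n-1)/2}\sum_{k=0}^n\#\{W\le\mathbb F_q^n : \dim W=k,\ aW\subseteq W\}\,\lambda^k\bar\lambda^{n-k},\] and if $\alpha\ne0$ the same formula holds with the condition $aW\subseteq W$ replaced by $aW=W$. -/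

import Mathlib

universe u

/-- The classical Kloosterman sum `K(α) = ∑_{x ∈ Eˣ} ψ(α x + x⁻¹)` over a finite field `E`. -/
noncomputable def kloostermanSum {E : Type u} [Field E] [Fintype E] [DecidableEq E]
    (ψ : AddChar E ℂ) (α : E) : ℂ :=
  ∑ x : Eˣ, ψ (α * (x : E) + ((x⁻¹ : Eˣ) : E))

/-- The matrix Kloosterman sum `K(a) = ∑_{x ∈ GL_n(F)} ψ(tr(a x + x⁻¹))`. -/
noncomputable def matrixKloostermanSum {F : Type u} [Field F] [Fintype F] [DecidableEq F]
    (ψ : AddChar F ℂ) {n : ℕ} (a : Matrix (Fin n) (Fin n) F) : ℂ :=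
  ∑ x : GL (Fin n) F,
    ψ (Matrix.trace (a * (x : Matrix (Fin n) (Fin n) F)
      + ((x⁻¹ : GL (Fin n) F) : Matrix (Fin n) (Fin n) F)))

/-- The additive character `ψ ∘ Tr_{E|F}` of an extension `E` of `F`. -/
noncomputable def extendChar {F : Type u} [Field F] (ψ : AddChar F ℂ)
    (E : Type u) [Field E] [Algebra F E] : AddChar E ℂ :=
  ψ.compAddMonoidHom (Algebra.trace F E).toAddMonoidHom

/-- The unordered pair `l₁, l₂` is the pair of Frobenius eigenvalues of the classical Kloosterman
sum `K(α)`: for every `m ≥ 1` and every extension `E` of `F` of degree `m`, the Kloosterman sum of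
`α` over `E` equals `-(l₁ ^ m + l₂ ^ m)`. Equivalently, the `L`-function
`exp (∑_{m ≥ 1} K(α, 𝔽_{q^m}) T ^ m / m)` is `(1 - l₁ T) (1 - l₂ T)`. For `α = 0`, where there is
only one nonzero eigenvalue, the pair is completed by `0`. -/
def IsFrobeniusPair {F : Type u} [Field F] [Fintype F] (ψ : AddChar F ℂ) (α : F)
    (l₁ l₂ : ℂ) : Prop :=
  ∀ (E : Type u) [Field E] [Fintype E] [DecidableEq E] [Algebra F E],
    kloostermanSum (extendChar ψ E) (algebraMap F E α)
      = -(l₁ ^ Module.finrank F E + l₂ ^ Module.finrank F E)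

/-- `α` is an eigenvalue of `a`, and it is the only one in the algebraic closure of `F`. -/
def HasUniqueEigenvalue {F : Type u} [Field F] {n : ℕ} (a : Matrix (Fin n) (Fin n) F)
    (α : F) : Prop :=
  ∀ β : AlgebraicClosure F,
    Module.End.HasEigenvalue
      (Matrix.toLin' (a.map (algebraMap F (AlgebraicClosure F)))) β ↔
    β = algebraMap F (AlgebraicClosure F) α

/-- The number of `k`-dimensional subspaces `W` of `F ^ n` with `a W ⊆ W`. -/
noncomputable def invariantSubspaceCount {F : Type u} [Field F] {n : ℕ}
    (a : Matrix (Fin n) (Fin n) F) (k : ℕ) : ℕ :=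
  Nat.card {W : Submodule F (Fin n → F) //
    Module.finrank F W = k ∧ W.map (Matrix.toLin' a) ≤ W}

/-- The number of `k`-dimensional subspaces `W` of `F ^ n` with `a W = W`. -/
noncomputable def stableSubspaceCount {F : Type u} [Field F] {n : ℕ}
    (a : Matrix (Fin n) (Fin n) F) (k : ℕ) : ℕ :=
  Nat.card {W : Submodule F (Fin n → F) //
    Module.finrank F W = k ∧ W.map (Matrix.toLin' a) = W}

/-!
Write `a = α + N` with `N` nilpotent, acting on `V = F ^ n`, and let `l₁, l₂` be the Frobenius
eigenvalues of `K(α)`. The theorem compares the Kloosterman sum of `α + N` on `V` with the sum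
`H(V) = ∑_W l₁ ^ dim W * l₂ ^ codim W` over the `N`-invariant subspaces `W`. Both are shown to
satisfy the same recursion along a nonzero vector `v` in the kernel of `N`, in terms of the
quotients `V / ⟨v⟩` and `V / ⟨v, w⟩`, where `w` runs over the vectors outside `⟨v⟩` with
`N w ∈ ⟨v⟩`.

*Kloosterman sums* (`endKloostermanSum_eq_sum_quotientEnd`). Sort the `x ∈ GL(V)` by `w = x v`.
Averaging over conjugation by the transvections `1 + φ(·) v` kills all `x` with
`N x v ∉ ⟨v⟩`; averaging over right multiplication by the same transvections kills, among the `x`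
with `x v = w`, those for which `x⁻¹ v - α w ∉ ⟨v⟩`. The surviving `x` stabilize `⟨v⟩` or the plane
`⟨v, w⟩`. The sum over such a stabilizer factors into a sum over the subspace, which is `K(α)` or an
elementary sum over a plane, and the Kloosterman sum of the quotient (`sum_stabilizer_eq`).

*Invariant subspaces* (`invariantSubspaceSum_eq_sum_quotientEnd`). The `W` containing `v` give
`l₁ H(V / ⟨v⟩)`. The others are complements of `⟨v⟩` in the invariant subspaces `U ∋ v`; in a given
`U` they correspond to the functionals on `U / N U` with value `1` at `v`, and their number is
`q⁻¹` times a character sum over the `w ∈ U` with `N w ∈ ⟨v⟩` (`card_mul_sum_complement_eq_sum`).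

Matching the two recursions only needs `l₁ + l₂ = -K(α)` and `l₁ l₂ = q`, or `l₁ l₂ = 0` if `α = 0`.
These relations, and the existence of the pair, come from the `L`-function of the completely
multiplicative function `f ↦ ψ (∑ (α r + r⁻¹))` on monic polynomials, with the sum over the roots
`r` of `f`. Its coefficients are `1`, `K(α)`, `q` or `0`, and then `0`. Counting the prime powers
dividing a polynomial yields Newton's identities (`natCast_mul_lCoeff_eq_sum`) between these
coefficients and the sums `primeSum` over powers of irreducible polynomials, which are the
Kloosterman sums over the extensions of `F` (`kloostermanSum_extendChar_eq_primeSum`). Degrees one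
and two suffice to recover `l₁ + l₂` and `l₁ l₂` from any pair of Frobenius eigenvalues.
-/

open Module

namespace MatrixKloosterman

attribute [local instance] Fintype.ofFinite

/-! ### Character sums over finite vector spaces -/

section Averaging

variable {F : Type*} [Field F] {ψ : AddChar F ℂ}

open scoped Classical in
theorem sum_addChar_comp_linearMap (hψ : ψ ≠ 1) {A : Type*} [AddCommGroup A] [Module F A]
    [Fintype A] (ℓ : A →ₗ[F] F) :
    ∑ t : A, ψ (ℓ t) = if ℓ = 0 then (Nat.card A : ℂ) else 0 := by
  split_ifs with h
  · simp [h]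
  · have h1 : ψ.compAddMonoidHom ℓ.toAddMonoidHom ≠ 1 := by
      obtain ⟨c, hc⟩ := AddChar.ne_one_iff.1 hψ
      obtain ⟨t, rfl⟩ := LinearMap.surjective h c
      exact AddChar.ne_one_iff.2 ⟨t, hc⟩
    simpa using AddChar.sum_eq_zero_of_ne_one h1

/-- Averaging over a vector space `A` of permutations `σ t`: if `f ∘ σ t` is `f` times the character
`t ↦ ψ (ℓ x t)`, then only the points where that character is trivial contribute to `∑ f`. -/
theorem sum_eq_sum_ite_of_twist (hψ : ψ ≠ 1) {A X : Type*} [AddCommGroup A] [Module F A]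
    [Finite A] [Fintype X] (f : X → ℂ) (σ : A → Equiv.Perm X) (ℓ : X → A →ₗ[F] F)
    [∀ x, Decidable (ℓ x = 0)]
    (h : ∀ t x, f (σ t x) = ψ (ℓ x t) * f x) :
    ∑ x, f x = ∑ x, if ℓ x = 0 then f x else 0 := by
  classical
  have h0 : (Nat.card A : ℂ) ≠ 0 := by
    simp
  refine mul_left_cancel₀ h0 ?_
  calc (Nat.card A : ℂ) * ∑ x, f x = ∑ t : A, ∑ x, f (σ t x) := by
        simp [fun t : A => Equiv.sum_comp (σ t) f]
    _ = ∑ x, (∑ t : A, ψ (ℓ x t)) * f x := by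
        rw [Finset.sum_comm]
        simp only [h, Finset.sum_mul]
    _ = _ := by
        rw [Finset.mul_sum]
        refine Finset.sum_congr rfl fun x _ => ?_
        rw [sum_addChar_comp_linearMap hψ]
        split_ifs <;> simp

end Averaging

/-! ### Kloosterman sums of endomorphisms -/

section Defs

variable {F V : Type*} [Field F] [AddCommGroup V] [Module F V]

instance finite_linearEquiv [Finite V] : Finite (V ≃ₗ[F] V) := DFunLike.finite _

instance finite_linearMap [Finite V] {W : Type*} [AddCommGroup W] [Module F W] [Finite W] :
    Finite (W →ₗ[F] V) := DFunLike.finite _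

instance finite_quotient [Finite V] (U : Submodule F V) : Finite (V ⧸ U) :=
  Finite.of_surjective _ U.mkQ_surjective

/-- The argument `tr ((α + N) x + x⁻¹)` of the character in the Kloosterman sum of `α + N`. -/
noncomputable def kloostermanTrace (α : F) (N : End F V) (x : V ≃ₗ[F] V) : F :=
  LinearMap.trace F V (α • (x : V →ₗ[F] V) + N ∘ₗ (x : V →ₗ[F] V) + (x.symm : V →ₗ[F] V))

/-- The Kloosterman sum `∑_{x ∈ GL(V)} ψ (tr ((α + N) x + x⁻¹))` of the endomorphism `α + N` of a
finite vector space `V`. -/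
noncomputable def endKloostermanSum [Finite V] (ψ : AddChar F ℂ) (α : F) (N : End F V) : ℂ :=
  ∑ x : V ≃ₗ[F] V, ψ (kloostermanTrace α N x)

open scoped Classical in
/-- The endomorphism that `N` induces on `V ⧸ U` if `U` is invariant under `N`; the junk value
`0` otherwise. -/
noncomputable def quotientEnd (N : End F V) (U : Submodule F V) : End F (V ⧸ U) :=
  if h : U ≤ U.comap N then U.mapQ U N h else 0

theorem quotientEnd_mk {N : End F V} {U : Submodule F V} (h : U ∈ End.invtSubmodule N) (v : V) :
    quotientEnd N U (U.mkQ v) = U.mkQ (N v) := by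
  rw [quotientEnd, dif_pos ((End.mem_invtSubmodule N).1 h)]
  simp

theorem isNilpotent_quotientEnd {N : End F V} (hN : IsNilpotent N) (U : Submodule F V) :
    IsNilpotent (quotientEnd N U) := by
  by_cases h : U ∈ End.invtSubmodule N
  · obtain ⟨k, hk⟩ := hN
    have key : ∀ (k : ℕ) (v : V), (quotientEnd N U ^ k) (U.mkQ v) = U.mkQ ((N ^ k) v) := by
      intro k
      induction k with
      | zero => simp
      | succ k ih =>
        intro v
        rw [pow_succ', pow_succ', End.mul_apply, ih, quotientEnd_mk h, End.mul_apply]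
    refine ⟨k, LinearMap.ext fun p => ?_⟩
    obtain ⟨v, rfl⟩ := U.mkQ_surjective p
    rw [key, hk]
    simp
  · rw [quotientEnd, dif_neg fun h' => h ((End.mem_invtSubmodule N).2 h')]
    exact IsNilpotent.zero

end Defs

/-! ### Restriction of the summation range -/

section Restrict

variable {F V : Type*} [Field F] [AddCommGroup V] [Module F V] {ψ : AddChar F ℂ}

theorem trace_comp_smulRight [FiniteDimensional F V] (b : End F V) (φ : Dual F V) (v : V) :
    LinearMap.trace F V (b ∘ₗ φ.smulRight v) = φ (b v) := by
  have h : b ∘ₗ φ.smulRight v = φ.smulRight (b v) := by ext; simp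
  rw [h, LinearMap.trace_smulRight]

theorem trace_smulRight_comp [FiniteDimensional F V] (b : End F V) (φ : Dual F V) (v : V) :
    LinearMap.trace F V (φ.smulRight v ∘ₗ b) = φ (b v) := by
  rw [LinearMap.trace_comp_comm', trace_comp_smulRight]

theorem kloostermanTrace_eq (α : F) (N : End F V) (x : V ≃ₗ[F] V) :
    kloostermanTrace α N x = α * LinearMap.trace F V (x : V →ₗ[F] V)
      + LinearMap.trace F V (N ∘ₗ (x : V →ₗ[F] V))
      + LinearMap.trace F V (x.symm : V →ₗ[F] V) := by
  simp [kloostermanTrace]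

theorem coe_transvection {φ : Dual F V} {v : V} (h : φ v = 0) :
    (LinearEquiv.transvection h : V →ₗ[F] V) = LinearMap.id + φ.smulRight v := by
  ext x; simp [LinearMap.transvection.apply]

theorem coe_transvection_symm {φ : Dual F V} {v : V} (h : φ v = 0) :
    ((LinearEquiv.transvection h).symm : V →ₗ[F] V) = LinearMap.id - φ.smulRight v := by
  ext x
  rw [LinearEquiv.coe_coe, LinearEquiv.symm_apply_eq]
  simp [LinearMap.transvection.apply, h]

theorem apply_eq_zero_of_mem_dualAnnihilator {U : Submodule F V} {φ : Dual F V}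
    (hφ : φ ∈ U.dualAnnihilator) {v : V} (hv : v ∈ U) : φ v = 0 :=
  (Submodule.mem_dualAnnihilator φ).1 hφ v hv

/-- The evaluation at `v` vanishes on the annihilator of `U` only if `v ∈ U`: this turns the
condition in `sum_eq_sum_ite_of_twist` into membership in a subspace. -/
theorem dual_eval_comp_subtype_eq_zero_iff (U : Submodule F V) (v : V) :
    (Dual.eval F V v) ∘ₗ U.dualAnnihilator.subtype = 0 ↔ v ∈ U := by
  rw [← Subspace.forall_mem_dualAnnihilator_apply_eq_zero_iff U v]
  constructor
  · intro h φ hφ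
    exact LinearMap.congr_fun h ⟨φ, hφ⟩
  · intro h
    ext φ
    exact h φ.1 φ.2

open scoped Classical in
/-- Conjugating `x` by the transvections `1 + φ(·) v`, where `N v = 0` and `φ v = 0`, changes
`tr (N x)` by `φ (N x v)`; hence only those `x` contribute for which `N x v` is a multiple
of `v`. -/
theorem endKloostermanSum_eq_sum_apply_mem_span [Finite F] [Finite V] (hψ : ψ ≠ 1) (α : F)
    {N : End F V} {v : V}
    (hv : N v = 0) :
    endKloostermanSum ψ α N = ∑ x : V ≃ₗ[F] V,
      if N (x v) ∈ Submodule.span F {v} then ψ (kloostermanTrace α N x) else 0 := by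
  have hφ (φ : (Submodule.span F {v}).dualAnnihilator) : φ.1 v = 0 :=
    apply_eq_zero_of_mem_dualAnnihilator φ.2 (Submodule.mem_span_singleton_self v)
  rw [endKloostermanSum, sum_eq_sum_ite_of_twist hψ _
    (fun φ : (Submodule.span F {v}).dualAnnihilator =>
      (MulAut.conj (LinearEquiv.transvection (hφ φ))⁻¹).toEquiv)
    (fun x => (Dual.eval F V (N (x v))) ∘ₗ (Submodule.span F {v}).dualAnnihilator.subtype)]
  · simp only [dual_eval_comp_subtype_eq_zero_iff]
  · intro φ x
    rw [← AddChar.map_add_eq_mul]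
    congr 1
    set g := LinearEquiv.transvection (hφ φ) with hg
    have hs : (MulAut.conj g⁻¹).toEquiv x = (g.trans x).trans g.symm := by
      ext y
      simp [LinearEquiv.mul_apply]
    have e1 : LinearMap.trace F V ((g.symm : V →ₗ[F] V) ∘ₗ (x : V →ₗ[F] V) ∘ₗ (g : V →ₗ[F] V))
        = LinearMap.trace F V (x : V →ₗ[F] V) := by
      rw [LinearMap.trace_comp_comm', LinearMap.comp_assoc]
      simp
    have e2 : LinearMap.trace F V
        ((g.symm : V →ₗ[F] V) ∘ₗ (x.symm : V →ₗ[F] V) ∘ₗ (g : V →ₗ[F] V))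
        = LinearMap.trace F V (x.symm : V →ₗ[F] V) := by
      rw [LinearMap.trace_comp_comm', LinearMap.comp_assoc]
      simp
    have e3 : (g : V →ₗ[F] V) ∘ₗ N ∘ₗ (g.symm : V →ₗ[F] V) = N + (φ.1 ∘ₗ N).smulRight v := by
      rw [hg, coe_transvection, coe_transvection_symm]
      ext y
      simp [hv]
    have e4 : LinearMap.trace F V
        (N ∘ₗ (g.symm : V →ₗ[F] V) ∘ₗ (x : V →ₗ[F] V) ∘ₗ (g : V →ₗ[F] V))
        = LinearMap.trace F V (N ∘ₗ (x : V →ₗ[F] V)) + φ.1 (N (x v)) := by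
      have e5 : (φ.1 ∘ₗ N).smulRight v ∘ₗ (x : V →ₗ[F] V)
          = (φ.1 ∘ₗ N ∘ₗ (x : V →ₗ[F] V)).smulRight v := rfl
      rw [← LinearMap.comp_assoc, ← LinearMap.comp_assoc, LinearMap.trace_comp_comm',
        ← LinearMap.comp_assoc, e3, LinearMap.add_comp, map_add, e5, LinearMap.trace_smulRight]
      rfl
    rw [hs, kloostermanTrace_eq, kloostermanTrace_eq]
    have c1 : ((((g.trans x).trans g.symm : V ≃ₗ[F] V)) : V →ₗ[F] V)
        = (g.symm : V →ₗ[F] V) ∘ₗ (x : V →ₗ[F] V) ∘ₗ (g : V →ₗ[F] V) := rfl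
    have c2 : ((((g.trans x).trans g.symm : V ≃ₗ[F] V).symm) : V →ₗ[F] V)
        = (g.symm : V →ₗ[F] V) ∘ₗ (x.symm : V →ₗ[F] V) ∘ₗ (g : V →ₗ[F] V) := rfl
    rw [c1, c2, e1, e2, e4]
    simp only [LinearMap.comp_apply, Submodule.subtype_apply, Dual.eval_apply]
    ring

open scoped Classical in
/-- Multiplying `x` on the right by the transvections `1 + ξ(·) v`, where `ξ v = 0`, fixes the value
`x v = w` and changes the trace by `ξ (α w - x⁻¹ v)`, provided that `N w` is a multiple of `v`;
hence only those `x` contribute for which `x⁻¹ v - α w` is a multiple of `v`. -/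
theorem sum_apply_eq_eq_sum_symm_apply_mem [Finite F] [Finite V] (hψ : ψ ≠ 1) (α : F)
    {N : End F V} {v w : V}
    (hw : N w ∈ Submodule.span F {v}) :
    (∑ x : V ≃ₗ[F] V, if x v = w then ψ (kloostermanTrace α N x) else 0)
      = ∑ x : V ≃ₗ[F] V, if x v = w ∧ α • w - x.symm v ∈ Submodule.span F {v} then
          ψ (kloostermanTrace α N x) else 0 := by
  have hφ (φ : (Submodule.span F {v}).dualAnnihilator) : φ.1 v = 0 :=
    apply_eq_zero_of_mem_dualAnnihilator φ.2 (Submodule.mem_span_singleton_self v)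
  rw [sum_eq_sum_ite_of_twist hψ _
    (fun φ : (Submodule.span F {v}).dualAnnihilator =>
      Equiv.mulRight (LinearEquiv.transvection (hφ φ)))
    (fun x => (Dual.eval F V (α • w - x.symm v)) ∘ₗ
      (Submodule.span F {v}).dualAnnihilator.subtype)]
  · simp only [dual_eval_comp_subtype_eq_zero_iff]
    refine Finset.sum_congr rfl fun x _ => ?_
    by_cases h1 : x v = w <;> by_cases h2 : α • w - x.symm v ∈ Submodule.span F {v} <;>
      simp [h1, h2]
  · intro φ x
    set g := LinearEquiv.transvection (hφ φ) with hg
    have hgv : (Equiv.mulRight g x) v = x v := by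
      change x (g v) = x v
      rw [hg]
      simp [LinearMap.transvection.apply, hφ φ]
    rw [hgv]
    split_ifs with hxv
    swap
    · simp
    rw [← AddChar.map_add_eq_mul]
    congr 1
    have c1 : ((Equiv.mulRight g x : V ≃ₗ[F] V) : V →ₗ[F] V)
        = (x : V →ₗ[F] V) ∘ₗ (g : V →ₗ[F] V) := rfl
    have c2 : ((Equiv.mulRight g x : V ≃ₗ[F] V).symm : V →ₗ[F] V)
        = (g.symm : V →ₗ[F] V) ∘ₗ (x.symm : V →ₗ[F] V) := rfl
    have hNw : φ.1 (N w) = 0 := apply_eq_zero_of_mem_dualAnnihilator φ.2 hw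
    have e : (Dual.eval F V (α • w - x.symm v) ∘ₗ (Submodule.span F {v}).dualAnnihilator.subtype) φ
        = α * φ.1 w - φ.1 (x.symm v) := by
      change φ.1 (α • w - x.symm v) = _
      rw [map_sub, map_smul, smul_eq_mul]
    rw [e, kloostermanTrace_eq, kloostermanTrace_eq, c1, c2, hg, coe_transvection,
      coe_transvection_symm, ← LinearMap.comp_assoc]
    simp only [LinearMap.comp_add, LinearMap.sub_comp, map_add, map_sub, LinearMap.comp_id,
      LinearMap.id_comp, trace_comp_smulRight, trace_smulRight_comp]
    simp only [LinearMap.comp_apply, LinearEquiv.coe_coe, hxv, hNw]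
    ring

end Restrict

/-! ### Sums over the stabilizer of a subspace -/

section Parabolic

variable {F V : Type*} [Field F] [AddCommGroup V] [Module F V]

/-- A choice of complement of `U`, as an isomorphism with `(V ⧸ U) × U`. -/
theorem exists_quotient_prod_equiv (U : Submodule F V) :
    ∃ e : ((V ⧸ U) × U) ≃ₗ[F] V, (∀ u : U, e (0, u) = u) ∧ ∀ z, U.mkQ (e z) = z.1 := by
  obtain ⟨s, hs⟩ := U.mkQ.exists_rightInverse_of_surjective U.range_mkQ
  have hs' (p : V ⧸ U) : U.mkQ (s p) = p := LinearMap.congr_fun hs p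
  have hU (u : U) : U.mkQ (u : V) = 0 := by simp
  have h1 (z : (V ⧸ U) × U) : s.coprod U.subtype z = s z.1 + z.2 := rfl
  have hb : Function.Bijective (s.coprod U.subtype) := by
    constructor
    · rw [← LinearMap.ker_eq_bot, LinearMap.ker_eq_bot']
      rintro ⟨p, u⟩ h
      rw [h1] at h
      have hp : p = 0 := by
        have := congrArg U.mkQ h
        rwa [map_add, hs', hU, add_zero, map_zero] at this
      subst hp
      simpa using h
    · intro v
      have hv : v - s (U.mkQ v) ∈ U := by
        rw [← Submodule.Quotient.mk_eq_zero, ← Submodule.mkQ_apply, map_sub, hs', sub_self]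
      exact ⟨(U.mkQ v, ⟨_, hv⟩), by simp [h1]⟩
  refine ⟨LinearEquiv.ofBijective _ hb, fun u => ?_, fun z => ?_⟩
  · rw [LinearEquiv.ofBijective_apply, h1]
    simp
  · rw [LinearEquiv.ofBijective_apply, h1, map_add, hs', hU, add_zero]

theorem mkQ_symm_fst {U : Submodule F V} {e : ((V ⧸ U) × U) ≃ₗ[F] V}
    (he : ∀ z, U.mkQ (e z) = z.1) (v : V) : (e.symm v).1 = U.mkQ v := by
  rw [← he, e.apply_symm_apply]

/-- The trace is additive along an invariant subspace. -/
theorem trace_eq_trace_add_trace_quotient [FiniteDimensional F V] {U : Submodule F V}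
    {b : End F V} {bU : End F U} {bQ : End F (V ⧸ U)} (hU : ∀ u : U, b u = bU u)
    (hQ : ∀ v, bQ (U.mkQ v) = U.mkQ (b v)) :
    LinearMap.trace F V b = LinearMap.trace F U bU + LinearMap.trace F (V ⧸ U) bQ := by
  obtain ⟨e, he0, he⟩ := exists_quotient_prod_equiv U
  have hes (u : U) : e.symm (u : V) = (0, u) := by rw [← he0, e.symm_apply_apply]
  -- In the decomposition `(V ⧸ U) × U` the endomorphism `b` is block triangular, with off-diagonal
  -- block `h`.
  set h : (V ⧸ U) →ₗ[F] U := LinearMap.snd F _ _ ∘ₗ e.symm.toLinearMap ∘ₗ b ∘ₗ e.toLinearMap ∘ₗ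
    LinearMap.inl F _ _ with hh
  have key : e.symm.conj b = bQ.prodMap bU
      + LinearMap.inr F (V ⧸ U) U ∘ₗ h ∘ₗ LinearMap.fst F (V ⧸ U) U := by
    apply LinearMap.ext
    rintro ⟨p, u⟩
    have h1 : e (p, u) = e (p, 0) + u := by rw [← he0 u, ← map_add]; simp
    have h2 : (e.symm (b (e (p, 0)))).1 = bQ p := by
      rw [mkQ_symm_fst he, ← hQ, he]
    have h3 : (e.symm (b (e (p, 0)))).2 = h p := rfl
    rw [LinearEquiv.conj_apply_apply]
    simp only [LinearEquiv.symm_symm, h1, map_add, hU, hes]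
    ext
    · simp [h2]
    · simp [h3, add_comm]
  rw [← LinearMap.trace_conj' b e.symm, key, map_add, LinearMap.trace_prodMap',
    LinearMap.trace_comp_comm', LinearMap.comp_assoc]
  have : LinearMap.fst F (V ⧸ U) U ∘ₗ LinearMap.inr F (V ⧸ U) U = 0 := by
    ext; simp
  rw [this]
  simp [add_comm]

theorem kloostermanTrace_eq_add_quotient [FiniteDimensional F V] (α : F) {N : End F V}
    {U : Submodule F V} (hU : U ∈ End.invtSubmodule N) (hN : ∀ u ∈ U, N u ∈ U)
    {x : V ≃ₗ[F] V} {y : U ≃ₗ[F] U} {z : (V ⧸ U) ≃ₗ[F] (V ⧸ U)} (hy : ∀ u : U, x u = y u)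
    (hz : ∀ v, z (U.mkQ v) = U.mkQ (x v)) :
    kloostermanTrace α N x
      = kloostermanTrace α (N.restrict hN) y + kloostermanTrace α (quotientEnd N U) z := by
  apply trace_eq_trace_add_trace_quotient
  · intro u
    have : x.symm u = y.symm u := by
      rw [LinearEquiv.symm_apply_eq, hy]; simp
    simp [hy, this]
  · intro v
    have : z.symm (U.mkQ v) = U.mkQ (x.symm v) := by
      rw [LinearEquiv.symm_apply_eq, hz]; simp
    simp only [LinearMap.add_apply, LinearMap.smul_apply, LinearMap.comp_apply,
      LinearEquiv.coe_coe, hz, this, quotientEnd_mk hU, map_add, map_smul]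

/-- The part of a Kloosterman sum over the stabilizer of an invariant subspace `U`, weighted by a
function of the restriction to `U`: it factors into the sums over `GL(U)` and over `GL(V ⧸ U)`, and
the unipotent radical `Hom(V ⧸ U, U)` contributes its cardinality. -/
theorem sum_stabilizer_eq [Finite F] [Finite V] (ψ : AddChar F ℂ) (α : F) {N : End F V}
    {U : Submodule F V} (hU : U ∈ End.invtSubmodule N) (hN : ∀ u ∈ U, N u ∈ U)
    {g : (V ≃ₗ[F] V) → ℂ} {f : (U ≃ₗ[F] U) → ℂ}
    (hg : ∀ x y, (∀ u : U, x u = y u) → g x = f y)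
    (hg0 : ∀ x, (∃ u ∈ U, x u ∉ U) → g x = 0) :
    ∑ x, g x * ψ (kloostermanTrace α N x)
      = (Nat.card F : ℂ) ^ (finrank F U * finrank F (V ⧸ U))
        * (∑ y, f y * ψ (kloostermanTrace α (N.restrict hN) y))
        * endKloostermanSum ψ α (quotientEnd N U) := by
  obtain ⟨e, he0, he⟩ := exists_quotient_prod_equiv U
  have hes (u : U) : e.symm (u : V) = (0, u) := by rw [← he0, e.symm_apply_apply]
  -- `Φ` parametrizes the stabilizer of `U` by block triangular automorphisms.
  set Φ : ((V ⧸ U) →ₗ[F] U) × (U ≃ₗ[F] U) × ((V ⧸ U) ≃ₗ[F] (V ⧸ U)) → (V ≃ₗ[F] V) :=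
    fun t => e.symm.trans ((t.2.2.skewProd t.2.1 t.1).trans e) with hΦ
  have hΦa (t) (v : V) :
      Φ t v = e (t.2.2 (e.symm v).1, t.2.1 (e.symm v).2 + t.1 (e.symm v).1) := rfl
  have hΦU (t) (u : U) : Φ t u = t.2.1 u := by rw [hΦa, hes]; simp [he0]
  have hΦQ (t) (v : V) : t.2.2 (U.mkQ v) = U.mkQ (Φ t v) := by
    rw [hΦa, he, mkQ_symm_fst he]
  have hinj : Function.Injective Φ := by
    rintro ⟨h, y, z⟩ ⟨h', y', z'⟩ hh
    have hy : y = y' := by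
      ext u
      rw [← hΦU (h, y, z) u, hh, hΦU]
    have hz : z = z' := by
      apply LinearEquiv.ext
      intro p
      obtain ⟨v, rfl⟩ := U.mkQ_surjective p
      rw [hΦQ (h, y, z) v, hh, ← hΦQ]
    subst hy hz
    have : h = h' := by
      apply LinearMap.ext
      intro p
      have h1 := congrArg (fun x : V ≃ₗ[F] V => e.symm (x (e (p, 0)))) hh
      simpa [hΦa] using h1
    rw [this]
  have hsurj (x : V ≃ₗ[F] V) (hx : x ∉ Set.range Φ) : ∃ u ∈ U, x u ∉ U := by
    by_contra! hcon
    have hmap : U.map (x : V →ₗ[F] V) = U := by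
      apply Submodule.eq_of_le_of_finrank_eq
      · rintro _ ⟨u, hu, rfl⟩
        exact hcon u hu
      · exact LinearEquiv.finrank_map_eq x U
    set y : U ≃ₗ[F] U := (x.submoduleMap U).trans (LinearEquiv.ofEq _ _ hmap) with hy
    have hyx (u : U) : x u = y u := rfl
    set z : (V ⧸ U) ≃ₗ[F] (V ⧸ U) := Submodule.Quotient.equiv U U x hmap with hz
    have hzx (v : V) : z (U.mkQ v) = U.mkQ (x v) := rfl
    refine hx ⟨(LinearMap.snd F _ _ ∘ₗ e.symm.toLinearMap ∘ₗ x.toLinearMap ∘ₗ e.toLinearMap ∘ₗ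
      LinearMap.inl F _ _, y, z), ?_⟩
    ext v
    obtain ⟨⟨p, u⟩, rfl⟩ := e.surjective v
    have h1 : e (p, u) = e (p, 0) + u := by rw [← he0 u, ← map_add]; simp
    rw [hΦa]
    apply e.symm.injective
    simp only [LinearEquiv.symm_apply_apply, h1, map_add, hyx, hes]
    ext
    · simp only [Prod.fst_add, add_zero, mkQ_symm_fst he, ← hzx, he]
    · simp [add_comm]
  rw [← Fintype.sum_of_injective Φ hinj
    (fun t => f t.2.1 * ψ (kloostermanTrace α (N.restrict hN) t.2.1)
      * ψ (kloostermanTrace α (quotientEnd N U) t.2.2)) _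
    (fun x hx => by rw [hg0 x (hsurj x hx), zero_mul])
    (fun t => by
      rw [hg _ _ (hΦU t), kloostermanTrace_eq_add_quotient α hU hN (hΦU t) (hΦQ t),
        AddChar.map_add_eq_mul, mul_assoc])]
  have hcard : Nat.card ((V ⧸ U) →ₗ[F] U) = Nat.card F ^ (finrank F U * finrank F (V ⧸ U)) := by
    rw [Module.natCard_eq_pow_finrank (K := F), Module.finrank_linearMap, mul_comm]
  rw [Fintype.sum_prod_type]
  simp only [Fintype.sum_prod_type, ← Finset.mul_sum, ← Finset.sum_mul, Finset.sum_const,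
    Finset.card_univ, ← Nat.card_eq_fintype_card, hcard, nsmul_eq_mul, endKloostermanSum]
  push_cast
  ring

end Parabolic

/-! ### The recursion for Kloosterman sums of nilpotent translates -/

section Recursion

variable {F V : Type*} [Field F] [AddCommGroup V] [Module F V] {ψ : AddChar F ℂ}

theorem endKloostermanSum_zero_of_finrank_eq_one [Fintype F] [DecidableEq F] [Finite V]
    (hV : finrank F V = 1) (α : F) :
    endKloostermanSum ψ α (0 : End F V) = kloostermanSum ψ α := by
  have : Nontrivial V := Module.nontrivial_of_finrank_pos (R := F) (by omega)
  rw [endKloostermanSum, kloostermanSum]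
  symm
  have hs (c : Fˣ) : ((LinearEquiv.smulOfUnit c : V ≃ₗ[F] V) : V →ₗ[F] V)
      = (c : F) • LinearMap.id := rfl
  have hs' (c : Fˣ) : ((LinearEquiv.smulOfUnit c : V ≃ₗ[F] V).symm : V →ₗ[F] V)
      = ((c⁻¹ : Fˣ) : F) • LinearMap.id := rfl
  refine Fintype.sum_bijective (fun c : Fˣ => (LinearEquiv.smulOfUnit c : V ≃ₗ[F] V)) ⟨?_, ?_⟩
    _ _ fun c => ?_
  · intro c d h
    obtain ⟨v, hv⟩ := exists_ne (0 : V)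
    have h1 : (c : F) • v = (d : F) • v := LinearEquiv.congr_fun h v
    exact Units.ext (smul_left_injective F hv h1)
  · intro x
    obtain ⟨v, hv, hv'⟩ := finrank_eq_one_iff'.1 hV
    obtain ⟨c, hc⟩ := hv' (x v)
    have hc0 : c ≠ 0 := by
      rintro rfl
      rw [zero_smul] at hc
      exact hv (x.map_eq_zero_iff.1 hc.symm)
    refine ⟨Units.mk0 c hc0, LinearEquiv.ext fun w => ?_⟩
    obtain ⟨d, rfl⟩ := hv' w
    change c • d • v = x (d • v)
    rw [map_smul, ← hc, smul_comm]
  · rw [kloostermanTrace_eq, hs, hs']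
    simp [hV]

/-- The automorphism of a plane with basis `b` that maps `b 0` to `b 1` and whose inverse maps
`b 0` to `α b 1 + c b 0`. -/
noncomputable def planeEquiv (b : Basis (Fin 2) F V) {α : F} (hα : α ≠ 0) (c : F) : V ≃ₗ[F] V :=
  LinearEquiv.ofLinearMap (b.constr F ![b 1, α⁻¹ • (b 0 - c • b 1)])
    (b.constr F ![α • b 1 + c • b 0, b 0])
    (b.ext fun i => by fin_cases i <;> simp [hα])
    (b.ext fun i => by fin_cases i <;> simp [hα])

section Plane

variable (b : Basis (Fin 2) F V) {α : F} (hα : α ≠ 0) (c : F)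

@[simp] theorem planeEquiv_zero : planeEquiv b hα c (b 0) = b 1 := by
  change b.constr F _ (b 0) = _
  simp

@[simp] theorem planeEquiv_one : planeEquiv b hα c (b 1) = α⁻¹ • (b 0 - c • b 1) := by
  change b.constr F _ (b 1) = _
  simp

@[simp] theorem planeEquiv_symm_zero :
    (planeEquiv b hα c).symm (b 0) = α • b 1 + c • b 0 := by
  change b.constr F _ (b 0) = _
  simp

@[simp] theorem planeEquiv_symm_one : (planeEquiv b hα c).symm (b 1) = b 0 := by
  change b.constr F _ (b 1) = _
  simp

/-- The trace does not depend on the parameter `c` of `planeEquiv`. -/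
theorem kloostermanTrace_planeEquiv [Finite V] {N : End F V} {β : F} (h0 : N (b 0) = 0)
    (h1 : N (b 1) = β • b 0) : kloostermanTrace α N (planeEquiv b hα c) = β := by
  rw [kloostermanTrace, LinearMap.trace_eq_matrix_trace F b, Matrix.trace_fin_two]
  simp [LinearMap.toMatrix_apply, h0, h1, hα]

include hα in
theorem sum_plane [Finite F] [Finite V]
    [∀ y : V ≃ₗ[F] V, Decidable (y (b 0) = b 1 ∧ α • b 1 - y.symm (b 0) ∈ Submodule.span F {b 0})]
    {N : End F V} {β : F} (h0 : N (b 0) = 0)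
    (h1 : N (b 1) = β • b 0) :
    (∑ y : V ≃ₗ[F] V, (if y (b 0) = b 1 ∧ α • b 1 - y.symm (b 0) ∈ Submodule.span F {b 0} then
      1 else 0) * ψ (kloostermanTrace α N y)) = Nat.card F * ψ β := by
  rw [← Fintype.sum_of_injective (planeEquiv b hα) _ (fun _ => ψ β)]
  · simp
  · intro y hy
    rw [if_neg, zero_mul]
    rintro ⟨hy1, hy2⟩
    obtain ⟨d, hd⟩ := Submodule.mem_span_singleton.1 hy2
    refine hy ⟨-d, ?_⟩
    rw [← LinearEquiv.symm_bijective.injective.eq_iff]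
    apply LinearEquiv.toLinearMap_injective
    refine b.ext fun i => ?_
    fin_cases i
    · simp only [Fin.zero_eta, LinearEquiv.coe_coe, planeEquiv_symm_zero, neg_smul, hd]
      abel
    · change (planeEquiv b hα (-d)).symm (b 1) = y.symm (b 1)
      rw [planeEquiv_symm_one, ← hy1, y.symm_apply_apply]
  · intro c
    rw [if_pos, kloostermanTrace_planeEquiv b hα c h0 h1, one_mul]
    refine ⟨by simp, Submodule.mem_span_singleton.2 ⟨-c, ?_⟩⟩
    simp
  · intro c d h
    have h2 : (planeEquiv b hα c).symm (b 0) = (planeEquiv b hα d).symm (b 0) := by rw [h]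
    rw [planeEquiv_symm_zero, planeEquiv_symm_zero, add_right_inj] at h2
    exact smul_left_injective F (b.ne_zero 0) h2

end Plane

open scoped Classical in
/-- The contribution to the Kloosterman sum of the `x` with `x v = w`, for a vector `w` outside
`⟨v⟩` with `N w ∈ ⟨v⟩`. -/
theorem sum_apply_eq_eq_mul_endKloostermanSum_quotientEnd [Finite F] [DecidableEq F]
    [Finite V] (hψ : ψ ≠ 1) (α : F) {N : End F V} {v w : V} (hv0 : v ≠ 0) (hv : N v = 0)
    (hw : w ∉ Submodule.span F {v}) {β : F} (hNw : N w = β • v) :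
    (∑ x : V ≃ₗ[F] V, if x v = w then ψ (kloostermanTrace α N x) else 0)
      = (if α = 0 then 0 else (Nat.card F : ℂ)) * ψ β * (Nat.card F : ℂ) ^ (2 * (finrank F V - 2))
        * endKloostermanSum ψ α (quotientEnd N (Submodule.span F {v, w})) := by
  rw [sum_apply_eq_eq_sum_symm_apply_mem hψ α
    (hNw ▸ Submodule.smul_mem _ _ (Submodule.mem_span_singleton_self v))]
  split_ifs with hα
  · -- For `α = 0` the condition says `x⁻¹ v ∈ ⟨v⟩`, which contradicts `x v = w ∉ ⟨v⟩`.
    simp only [zero_mul]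
    refine Finset.sum_eq_zero fun x _ => if_neg ?_
    rintro ⟨hx1, hx2⟩
    rw [hα, zero_smul, zero_sub, Submodule.neg_mem_iff] at hx2
    obtain ⟨d, hd⟩ := Submodule.mem_span_singleton.1 hx2
    have hd0 : d ≠ 0 := by
      rintro rfl
      rw [zero_smul] at hd
      exact hv0 (x.symm.map_eq_zero_iff.1 hd.symm)
    refine hw (Submodule.mem_span_singleton.2 ⟨d⁻¹, ?_⟩)
    rw [← hx1, inv_smul_eq_iff₀ hd0, ← map_smul, hd, x.apply_symm_apply]
  · set U := Submodule.span F {v, w} with hUdef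
    have hli : LinearIndependent F ![v, w] := by
      rw [LinearIndependent.pair_iff' hv0]
      exact fun c hc => hw (Submodule.mem_span_singleton.2 ⟨c, hc⟩)
    have hrange : Submodule.span F (Set.range ![v, w]) = U := by
      rw [Matrix.range_cons, Matrix.range_cons, Matrix.range_empty, Set.union_empty]
      rfl
    set b : Basis (Fin 2) F U := (Basis.span hli).map (LinearEquiv.ofEq _ _ hrange) with hb
    have hb0 : (b 0 : V) = v := by simp [hb, Basis.span_apply]
    have hb1 : (b 1 : V) = w := by simp [hb, Basis.span_apply]
    have hvU : v ∈ U := hb0 ▸ (b 0).2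
    have hwU : w ∈ U := hb1 ▸ (b 1).2
    have hfr : finrank F U = 2 := by rw [finrank_eq_card_basis b]; rfl
    have hN : ∀ u ∈ U, N u ∈ U := by
      intro u hu
      obtain ⟨c, d, rfl⟩ := Submodule.mem_span_pair.1 hu
      rw [map_add, map_smul, map_smul, hv, hNw, smul_zero, zero_add]
      exact U.smul_mem _ (U.smul_mem _ hvU)
    have hU : U ∈ End.invtSubmodule N := hN
    have h0 : N.restrict hN (b 0) = 0 := Subtype.ext (by simp [hb0, hv])
    have h1 : N.restrict hN (b 1) = β • b 0 := Subtype.ext (by simp [hb0, hb1, hNw])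
    have hfrQ : finrank F (V ⧸ U) = finrank F V - 2 := by
      have := U.finrank_quotient_add_finrank
      omega
    have hvb (c : V) (hc : c ∈ U) : c ∈ Submodule.span F {v}
        ↔ (⟨c, hc⟩ : U) ∈ Submodule.span F {b 0} := by
      simp only [Submodule.mem_span_singleton, Subtype.ext_iff, Submodule.coe_smul, hb0]
    have key := sum_stabilizer_eq ψ α hU hN
      (g := fun x => if x v = w ∧ α • w - x.symm v ∈ Submodule.span F {v} then 1 else 0)
      (f := fun y => if y (b 0) = b 1 ∧ α • b 1 - y.symm (b 0) ∈ Submodule.span F {b 0} then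
        1 else 0) ?_ ?_
    · rw [sum_plane b hα h0 h1, hfr, hfrQ] at key
      simp only [ite_mul, one_mul, zero_mul] at key
      rw [key]
      ring
    · intro x y hxy
      have e1 : x v = w ↔ y (b 0) = b 1 := by
        rw [Subtype.ext_iff, ← hxy, hb0, hb1]
      have e2 : x.symm v = y.symm (b 0) := by
        rw [LinearEquiv.symm_apply_eq, hxy, y.apply_symm_apply, hb0]
      have e3 : α • w - x.symm v = ((α • b 1 - y.symm (b 0) : U) : V) := by
        rw [e2, Submodule.coe_sub, Submodule.coe_smul, hb1]
      simp only [e1, e3, hvb _ (Subtype.coe_prop _), Subtype.coe_eta]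
    · rintro x ⟨u, hu, hxu⟩
      refine if_neg ?_
      rintro ⟨hx1, hx2⟩
      obtain ⟨d, hd⟩ := Submodule.mem_span_singleton.1 hx2
      have hxw : x w = α⁻¹ • (v + d • w) := by
        have h2 : d • w = α • x w - v := by
          rw [← hx1, ← map_smul, hd, map_sub, map_smul, x.apply_symm_apply, hx1]
        rw [eq_inv_smul_iff₀ hα, h2]
        abel
      obtain ⟨c, c', rfl⟩ := Submodule.mem_span_pair.1 hu
      refine hxu ?_
      rw [map_add, map_smul, map_smul, hx1, hxw]
      exact U.add_mem (U.smul_mem _ hwU)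
        (U.smul_mem _ (U.smul_mem _ (U.add_mem hvU (U.smul_mem _ hwU))))

open scoped Classical in
/-- The contribution to the Kloosterman sum of the `x` that stabilize the line `⟨v⟩`. -/
theorem sum_apply_mem_span_eq [Fintype F] [DecidableEq F] [Finite V] (α : F) {N : End F V} {v : V}
    (hv0 : v ≠ 0) (hv : N v = 0) :
    (∑ x : V ≃ₗ[F] V, if x v ∈ Submodule.span F {v} then ψ (kloostermanTrace α N x) else 0)
      = (Nat.card F : ℂ) ^ (finrank F V - 1) * kloostermanSum ψ α
        * endKloostermanSum ψ α (quotientEnd N (Submodule.span F {v})) := by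
  set U := Submodule.span F {v} with hUdef
  have hvU : v ∈ U := Submodule.mem_span_singleton_self v
  have hN0 : ∀ u ∈ U, N u = 0 := by
    intro u hu
    obtain ⟨c, rfl⟩ := Submodule.mem_span_singleton.1 hu
    rw [map_smul, hv, smul_zero]
  have hN : ∀ u ∈ U, N u ∈ U := fun u hu => by rw [hN0 u hu]; exact U.zero_mem
  have hfr : finrank F U = 1 := finrank_span_singleton hv0
  have hfrQ : finrank F (V ⧸ U) = finrank F V - 1 := by
    have := U.finrank_quotient_add_finrank
    omega
  have hres : N.restrict hN = 0 := by
    ext u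
    simp [hN0 u u.2]
  have key := sum_stabilizer_eq ψ α (N := N) (U := U) hN hN
    (g := fun x => if x v ∈ U then 1 else 0) (f := fun _ => 1) ?_ ?_
  · simp only [ite_mul, one_mul, zero_mul] at key
    rw [key, hfr, hfrQ, hres, one_mul, ← endKloostermanSum_zero_of_finrank_eq_one hfr α]
    rfl
  · intro x y hxy
    rw [if_pos]
    rw [hxy ⟨v, hvU⟩]
    exact Subtype.coe_prop _
  · rintro x ⟨u, hu, hxu⟩
    refine if_neg fun hx => hxu ?_
    obtain ⟨c, rfl⟩ := Submodule.mem_span_singleton.1 hu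
    rw [map_smul]
    exact U.smul_mem _ hx

open scoped Classical in
/-- The recursion for Kloosterman sums obtained by sorting `x ∈ GL(V)` by the value `w = x v` on a
fixed nonzero vector `v` in the kernel of `N`. If `dim V ≤ 1`, the sum over `w` is empty, so that
the truncated exponent `finrank F V - 2` does no harm. -/
theorem endKloostermanSum_eq_sum_quotientEnd [Fintype F] [DecidableEq F] [Finite V] (hψ : ψ ≠ 1)
    (α : F) {N : End F V} {v : V} (hv0 : v ≠ 0) (hv : N v = 0) {δ : Dual F V} (hδ : δ v = 1) :
    endKloostermanSum ψ α N
      = (Nat.card F : ℂ) ^ (finrank F V - 1) * kloostermanSum ψ α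
          * endKloostermanSum ψ α (quotientEnd N (Submodule.span F {v}))
        + ∑ w : V, if w ∉ Submodule.span F {v} ∧ N w ∈ Submodule.span F {v} then
            (if α = 0 then 0 else (Nat.card F : ℂ)) * ψ (δ (N w))
              * (Nat.card F : ℂ) ^ (2 * (finrank F V - 2))
              * endKloostermanSum ψ α (quotientEnd N (Submodule.span F {v, w})) else 0 := by
  rw [endKloostermanSum_eq_sum_apply_mem_span hψ α hv, ← sum_apply_mem_span_eq α hv0 hv]
  have h1 (w : V) : (if w ∉ Submodule.span F {v} ∧ N w ∈ Submodule.span F {v} then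
            (if α = 0 then 0 else (Nat.card F : ℂ)) * ψ (δ (N w))
              * (Nat.card F : ℂ) ^ (2 * (finrank F V - 2))
              * endKloostermanSum ψ α (quotientEnd N (Submodule.span F {v, w})) else 0)
      = ∑ x : V ≃ₗ[F] V, if x v = w then
          (if w ∉ Submodule.span F {v} ∧ N w ∈ Submodule.span F {v} then
            ψ (kloostermanTrace α N x) else 0) else 0 := by
    by_cases h : w ∉ Submodule.span F {v} ∧ N w ∈ Submodule.span F {v}
    · rw [if_pos h]
      obtain ⟨β, hβ⟩ := Submodule.mem_span_singleton.1 h.2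
      rw [← hβ, map_smul, hδ, smul_eq_mul, mul_one]
      simp only [hβ ▸ h, not_false_eq_true, and_self, if_true]
      exact (sum_apply_eq_eq_mul_endKloostermanSum_quotientEnd hψ α hv0 hv h.1 hβ.symm).symm
    · simp only [if_neg h, ite_self, Finset.sum_const_zero]
  rw [Finset.sum_congr rfl fun w _ => h1 w, Finset.sum_comm, ← Finset.sum_add_distrib]
  refine Finset.sum_congr rfl fun x _ => ?_
  rw [Finset.sum_ite_eq, if_pos (Finset.mem_univ _)]
  by_cases hx : x v ∈ Submodule.span F {v}
  · have : N (x v) = 0 := by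
      obtain ⟨c, hc⟩ := Submodule.mem_span_singleton.1 hx
      rw [← hc, map_smul, hv, smul_zero]
    simp [hx, this]
  · simp [hx]

end Recursion

/-! ### Counting invariant subspaces -/

section Count

variable {F V : Type*} [Field F] [AddCommGroup V] [Module F V] {ψ : AddChar F ℂ}

open scoped Classical in
/-- The sum of `x ^ dim W * y ^ codim W` over the `N`-invariant subspaces `W`. -/
noncomputable def invariantSubspaceSum [Finite V] (x y : ℂ) (N : End F V) : ℂ :=
  ∑ W : Submodule F V, if W ∈ End.invtSubmodule N then
    x ^ finrank F W * y ^ (finrank F V - finrank F W) else 0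

theorem mem_invtSubmodule_quotientEnd_iff {N : End F V} {U : Submodule F V}
    (hU : U ∈ End.invtSubmodule N) (W : Submodule F (V ⧸ U)) :
    W ∈ End.invtSubmodule (quotientEnd N U) ↔ W.comap U.mkQ ∈ End.invtSubmodule N := by
  constructor
  · intro h v hv
    have h1 : quotientEnd N U (U.mkQ v) ∈ W := h hv
    rwa [quotientEnd_mk hU] at h1
  · intro h p hp
    obtain ⟨v, rfl⟩ := U.mkQ_surjective p
    have h1 : U.mkQ (N v) ∈ W := h hp
    rwa [← quotientEnd_mk hU] at h1

theorem finrank_comap_mkQ [FiniteDimensional F V] (U : Submodule F V) (W : Submodule F (V ⧸ U)) :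
    finrank F (W.comap U.mkQ) = finrank F W + finrank F U := by
  have h1 : (W.comap U.mkQ).map U.mkQ = W := Submodule.map_comap_eq_of_surjective U.mkQ_surjective W
  have h2 := (Submodule.quotientQuotientEquivQuotient U _ (Submodule.le_comap_mkQ U W)).finrank_eq
  rw [h1] at h2
  have h3 := U.finrank_quotient_add_finrank
  have h4 := W.finrank_quotient_add_finrank
  have h5 := (W.comap U.mkQ).finrank_quotient_add_finrank
  omega

open scoped Classical in
theorem invariantSubspaceSum_quotientEnd [Finite V] (x y : ℂ) {N : End F V} {U : Submodule F V}
    (hU : U ∈ End.invtSubmodule N) :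
    invariantSubspaceSum x y (quotientEnd N U)
      = ∑ W : Submodule F V, if W ∈ End.invtSubmodule N ∧ U ≤ W then
          x ^ (finrank F W - finrank F U) * y ^ (finrank F V - finrank F W) else 0 := by
  refine Fintype.sum_of_injective (fun W => W.comap U.mkQ)
    (Submodule.comap_injective_of_surjective U.mkQ_surjective) _ _ ?_ ?_
  · intro W hW
    refine if_neg fun h => hW ⟨W.map U.mkQ, ?_⟩
    simp [Submodule.comap_map_eq, h.2]
  · intro W
    have h3 := U.finrank_quotient_add_finrank
    simp only [mem_invtSubmodule_quotientEnd_iff hU, Submodule.le_comap_mkQ, and_true,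
      finrank_comap_mkQ, Nat.add_sub_cancel]
    rw [show finrank F V - (finrank F W + finrank F U) = finrank F (V ⧸ U) - finrank F W by omega]

theorem card_dualAnnihilator_range [Finite V] (N : End F V) :
    Nat.card (LinearMap.range N).dualAnnihilator = Nat.card (LinearMap.ker N) := by
  rw [Module.natCard_eq_pow_finrank (K := F) (V := LinearMap.ker N),
    Module.natCard_eq_pow_finrank (K := F) (V := (LinearMap.range N).dualAnnihilator)]
  congr 1
  have h1 := Subspace.finrank_add_finrank_dualAnnihilator_eq (LinearMap.range N)
  have h2 := N.finrank_range_add_finrank_ker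
  omega

open scoped Classical in
theorem sum_ite_apply_eq [Finite V] (N : End F V) (u : V) :
    (∑ w : V, if N w = u then (1 : ℂ) else 0)
      = if u ∈ LinearMap.range N then (Nat.card (LinearMap.ker N) : ℂ) else 0 := by
  split_ifs with h
  · obtain ⟨w₀, rfl⟩ := h
    rw [← Fintype.sum_of_injective (fun k : LinearMap.ker N => w₀ + k) _ (fun _ => 1)]
    · simp
    · intro w hw
      refine if_neg fun h => hw ⟨⟨w - w₀, by simp [h]⟩, by simp⟩
    · intro k
      simp
    · intro k k' h
      exact Subtype.ext (add_left_cancel h)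
  · exact Finset.sum_eq_zero fun w _ => if_neg fun hw => h ⟨w, hw⟩

open scoped Classical in
/-- The functionals `f` with `f ∘ N = 0` and `f v = 1` are counted by a character sum. -/
theorem card_mul_card_dual_eq_sum [Finite F] [Finite V] (hψ : ψ ≠ 1) (N : End F V) {v : V}
    {δ : Dual F V} (hδ : δ v = 1) :
    (Nat.card F : ℂ) * Nat.card {f : (LinearMap.range N).dualAnnihilator // f.1 v = 1}
      = ∑ w : V, if N w ∈ Submodule.span F {v} then ψ (δ (N w)) else 0 := by
  have e1 (f : (LinearMap.range N).dualAnnihilator) :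
      ∑ t : F, ψ (t * f.1 v) * ψ (-t) = if f.1 v = 1 then (Nat.card F : ℂ) else 0 := by
    have h := sum_addChar_comp_linearMap hψ (LinearMap.mulRight F (f.1 v - 1))
    have h2 : LinearMap.mulRight F (f.1 v - 1) = 0 ↔ f.1 v = 1 := by
      rw [LinearMap.mulRight_eq_zero_iff, sub_eq_zero]
    simp only [h2] at h
    rw [← h]
    refine Finset.sum_congr rfl fun t _ => ?_
    rw [← AddChar.map_add_eq_mul]
    congr 1
    simp
    ring
  have e2 (t : F) : ∑ f : (LinearMap.range N).dualAnnihilator, ψ (t * f.1 v)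
      = ∑ w : V, if N w = t • v then (1 : ℂ) else 0 := by
    have h := sum_addChar_comp_linearMap hψ (A := (LinearMap.range N).dualAnnihilator)
      (Dual.eval F V (t • v) ∘ₗ (LinearMap.range N).dualAnnihilator.subtype)
    simp only [dual_eval_comp_subtype_eq_zero_iff] at h
    rw [sum_ite_apply_eq, ← card_dualAnnihilator_range, ← h]
    refine Finset.sum_congr rfl fun f _ => ?_
    congr 1
    change _ = f.1 (t • v)
    rw [map_smul, smul_eq_mul]
  have e3 : (Nat.card F : ℂ) * Nat.card {f : (LinearMap.range N).dualAnnihilator // f.1 v = 1}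
      = ∑ f : (LinearMap.range N).dualAnnihilator, if f.1 v = 1 then (Nat.card F : ℂ) else 0 := by
    rw [← Finset.sum_filter, Finset.sum_const,
      Nat.card_eq_fintype_card (α := {f : (LinearMap.range N).dualAnnihilator // f.1 v = 1}),
      Fintype.card_subtype, nsmul_eq_mul, mul_comm]
  have e4 (w : V) : (if N w ∈ Submodule.span F {v} then ψ (δ (N w)) else 0)
      = ∑ t : F, (if N w = t • v then ψ t else 0) := by
    split_ifs with h
    · obtain ⟨c, hc⟩ := Submodule.mem_span_singleton.1 h
      have hv : v ≠ 0 := by rintro rfl; simp at hδ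
      rw [← hc, map_smul, hδ, smul_eq_mul, mul_one]
      simp [(smul_left_injective F hv).eq_iff]
    · refine (Finset.sum_eq_zero fun t _ => if_neg fun ht => h ?_).symm
      rw [ht]
      exact Submodule.smul_mem _ _ (Submodule.mem_span_singleton_self v)
  -- Detect `f v = 1` by a sum over `t : F`; orthogonality in `f` leaves the `t` with `t v` in the
  -- range of `N`, which are the values counted on the right hand side.
  calc _ = ∑ t : F, (∑ f : (LinearMap.range N).dualAnnihilator, ψ (t * f.1 v)) * ψ (-t) := by
        rw [e3]
        simp only [← e1, Finset.sum_mul]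
        rw [Finset.sum_comm]
    _ = ∑ t : F, (∑ w : V, if N w = t • v then (1 : ℂ) else 0) * ψ t := by
        simp only [e2]
        refine Fintype.sum_equiv (Equiv.neg F) _ _ fun t => ?_
        congr 1
        refine Fintype.sum_equiv (Equiv.neg V) _ _ fun w => ?_
        simp
    _ = _ := by
        simp only [e4, Finset.sum_mul, ite_mul, one_mul, zero_mul]
        rw [Finset.sum_comm]

/-- Invariant complements of a line `⟨v⟩` in the kernel of `N` correspond to functionals `f` with
`f ∘ N = 0` and `f v = 1`. -/
theorem card_invariant_complement_eq [Finite V] {N : End F V} {v : V} (hv : N v = 0) :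
    Nat.card {W : Submodule F V // W ∈ End.invtSubmodule N ∧ v ∉ W ∧
        W ⊔ Submodule.span F {v} = ⊤}
      = Nat.card {f : (LinearMap.range N).dualAnnihilator // f.1 v = 1} := by
  have hfN (f : (LinearMap.range N).dualAnnihilator) (w : V) : f.1 (N w) = 0 :=
    apply_eq_zero_of_mem_dualAnnihilator f.2 ⟨w, rfl⟩
  symm
  refine Nat.card_congr (Equiv.ofBijective (fun f => ⟨LinearMap.ker f.1.1, ?_, ?_, ?_⟩) ⟨?_, ?_⟩)
  · intro w _
    exact hfN f.1 w
  · rw [LinearMap.mem_ker, f.2]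
    exact one_ne_zero
  · rw [eq_top_iff]
    intro w _
    refine Submodule.mem_sup.2 ⟨w - f.1.1 w • v, ?_, f.1.1 w • v,
      Submodule.smul_mem _ _ (Submodule.mem_span_singleton_self v), by abel⟩
    rw [LinearMap.mem_ker, map_sub, map_smul, f.2, smul_eq_mul, mul_one, sub_self]
  · rintro ⟨f, hf⟩ ⟨g, hg⟩ h
    have h1 : LinearMap.ker f.1 = LinearMap.ker g.1 := congrArg Subtype.val h
    refine Subtype.ext (Subtype.ext (LinearMap.ext fun w => ?_))
    have h2 : w - f.1 w • v ∈ LinearMap.ker f.1 := by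
      rw [LinearMap.mem_ker, map_sub, map_smul, hf, smul_eq_mul, mul_one, sub_self]
    rw [h1, LinearMap.mem_ker, map_sub, map_smul, hg, smul_eq_mul, mul_one, sub_eq_zero] at h2
    exact h2.symm
  · rintro ⟨W, hW, hvW, hsup⟩
    obtain ⟨f, hf0, hf⟩ := Submodule.exists_le_ker_of_notMem hvW
    have hdec (w : V) : ∃ u ∈ W, ∃ c : F, u + c • v = w := by
      have : w ∈ W ⊔ Submodule.span F {v} := hsup ▸ Submodule.mem_top
      obtain ⟨u, hu, z, hz, rfl⟩ := Submodule.mem_sup.1 this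
      obtain ⟨c, rfl⟩ := Submodule.mem_span_singleton.1 hz
      exact ⟨u, hu, c, rfl⟩
    refine ⟨⟨⟨(f v)⁻¹ • f, ?_⟩, ?_⟩, Subtype.ext ?_⟩
    · rw [Submodule.mem_dualAnnihilator]
      rintro _ ⟨w, rfl⟩
      obtain ⟨u, hu, c, rfl⟩ := hdec w
      have h1 : f (N u) = 0 := hf (hW hu)
      simp [hv, h1]
    · simp [hf0]
    · ext w
      obtain ⟨u, hu, c, rfl⟩ := hdec w
      have h1 : f u = 0 := hf hu
      have h2 : c • v ∈ W ↔ c = 0 := by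
        constructor
        · intro h
          by_contra hc
          exact hvW ((W.smul_mem_iff hc).1 h)
        · rintro rfl
          simp
      rw [W.add_mem_iff_right hu, h2]
      simp [h1, hf0]

open scoped Classical in
/-- For an invariant subspace `U` containing `v`, the number of invariant complements of `⟨v⟩` in
`U` as a character sum over `U`. -/
theorem card_mul_sum_complement_eq_sum [Finite F] [Finite V] (hψ : ψ ≠ 1) {N : End F V} {v : V}
    (hv : N v = 0) {δ : Dual F V} (hδ : δ v = 1) {U : Submodule F V}
    (hU : U ∈ End.invtSubmodule N) (hvU : v ∈ U) :
    (Nat.card F : ℂ) * (∑ W : Submodule F V,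
        if W ∈ End.invtSubmodule N ∧ v ∉ W ∧ W ⊔ Submodule.span F {v} = U then 1 else 0)
      = ∑ w : V, if w ∈ U ∧ N w ∈ Submodule.span F {v} then ψ (δ (N w)) else 0 := by
  have hN : ∀ u ∈ U, N u ∈ U := hU
  set N' : End F U := N.restrict hN with hN'
  set v' : U := ⟨v, hvU⟩ with hv'
  have hN'v : N' v' = 0 := Subtype.ext hv
  have hδ' : (δ ∘ₗ U.subtype) v' = 1 := hδ
  have hspan (u : U) : u ∈ Submodule.span F {v'} ↔ (u : V) ∈ Submodule.span F {v} := by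
    simp only [Submodule.mem_span_singleton, Subtype.ext_iff, Submodule.coe_smul, hv']
  have hmapspan : (Submodule.span F {v'}).map U.subtype = Submodule.span F {v} := by
    rw [Submodule.map_span, Set.image_singleton]
    rfl
  have key := card_mul_card_dual_eq_sum hψ N' hδ'
  rw [← card_invariant_complement_eq hN'v] at key
  have e1 : (∑ W : Submodule F V,
        if W ∈ End.invtSubmodule N ∧ v ∉ W ∧ W ⊔ Submodule.span F {v} = U then (1 : ℂ) else 0)
      = Nat.card {W : Submodule F U // W ∈ End.invtSubmodule N' ∧ v' ∉ W ∧
        W ⊔ Submodule.span F {v'} = ⊤} := by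
    rw [Nat.card_eq_fintype_card, Fintype.card_subtype, Finset.natCast_card_filter]
    symm
    refine Fintype.sum_of_injective (fun W => W.map U.subtype)
      (Submodule.map_injective_of_injective U.injective_subtype) _ _ ?_ ?_
    · intro W hW
      refine if_neg fun h => hW ⟨W.comap U.subtype, ?_⟩
      change (W.comap U.subtype).map U.subtype = W
      rw [Submodule.map_comap_subtype, inf_eq_right]
      exact h.2.2 ▸ le_sup_left
    · intro W
      have a1 : W ∈ End.invtSubmodule N' ↔ W.map U.subtype ∈ End.invtSubmodule N := by
        constructor
        · rintro h _ ⟨u, hu, rfl⟩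
          exact ⟨N' u, h hu, rfl⟩
        · intro h u hu
          obtain ⟨u', hu', h'⟩ := h (Submodule.mem_map_of_mem (f := U.subtype) hu)
          have : u' = N' u := Subtype.ext h'
          rw [this] at hu'
          exact hu'
      have a2 : v' ∉ W ↔ v ∉ W.map U.subtype := by
        rw [not_iff_not]
        constructor
        · intro h
          exact ⟨v', h, rfl⟩
        · rintro ⟨u, hu, h⟩
          have : u = v' := Subtype.ext h
          exact this ▸ hu
      have a3 : W ⊔ Submodule.span F {v'} = ⊤
          ↔ W.map U.subtype ⊔ Submodule.span F {v} = U := by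
        rw [← hmapspan, ← Submodule.map_sup]
        conv_rhs => rhs; rw [← Submodule.map_subtype_top U]
        exact (Submodule.map_injective_of_injective U.injective_subtype).eq_iff.symm
      simp only [a1, a2, a3]
  have e2 : (∑ w : V, if w ∈ U ∧ N w ∈ Submodule.span F {v} then ψ (δ (N w)) else 0)
      = ∑ w : U, if N' w ∈ Submodule.span F {v'} then ψ ((δ ∘ₗ U.subtype) (N' w)) else 0 := by
    symm
    refine Fintype.sum_of_injective (fun w : U => (w : V)) Subtype.coe_injective _ _ ?_ ?_
    · intro w hw
      refine if_neg fun h => hw ⟨⟨w, h.1⟩, rfl⟩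
    · intro w
      simp [hspan, hN']
  rw [e1, e2]
  convert key

open scoped Classical in
/-- The recursion for `invariantSubspaceSum` along a nonzero vector `v` in the kernel of `N`: the
invariant subspaces containing `v` are those of the quotient by `v`, and the others are sorted by
their sum with `⟨v⟩`. -/
theorem invariantSubspaceSum_eq_sum_quotientEnd [Finite F] [Finite V] (hψ : ψ ≠ 1) (x y : ℂ)
    {N : End F V} {v : V} (hv0 : v ≠ 0) (hv : N v = 0) {δ : Dual F V} (hδ : δ v = 1) :
    invariantSubspaceSum x y N
      = (x + y) * invariantSubspaceSum x y (quotientEnd N (Submodule.span F {v}))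
        + x * y / Nat.card F * ∑ w : V,
          if w ∉ Submodule.span F {v} ∧ N w ∈ Submodule.span F {v} then
            ψ (δ (N w)) * invariantSubspaceSum x y (quotientEnd N (Submodule.span F {v, w}))
          else 0 := by
  have hq : (Nat.card F : ℂ) ≠ 0 := by simp
  have hvL : v ∈ Submodule.span F {v} := Submodule.mem_span_singleton_self v
  have hfrL : finrank F (Submodule.span F {v}) = 1 := finrank_span_singleton hv0
  have hNL : ∀ u ∈ Submodule.span F {v}, N u = 0 := by
    intro u hu
    obtain ⟨c, rfl⟩ := Submodule.mem_span_singleton.1 hu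
    rw [map_smul, hv, smul_zero]
  have hL : Submodule.span F {v} ∈ End.invtSubmodule N := by
    intro u hu
    rw [Submodule.mem_comap, hNL u hu]
    exact Submodule.zero_mem _
  have hpos {U : Submodule F V} (hU : v ∈ U) : 1 ≤ finrank F U := by
    rw [← hfrL]
    exact Submodule.finrank_mono ((Submodule.span_singleton_le_iff_mem v U).2 hU)
  have hle (U : Submodule F V) : finrank F U ≤ finrank F V := U.finrank_le
  -- `t U` is the weight of a subspace `W` of codimension one in `U`.
  set t : Submodule F V → ℂ := fun U =>
    x ^ (finrank F U - 1) * y ^ (finrank F V - (finrank F U - 1)) with ht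
  have hsplit : invariantSubspaceSum x y N
      = (∑ W : Submodule F V, if W ∈ End.invtSubmodule N ∧ v ∈ W then
          x ^ finrank F W * y ^ (finrank F V - finrank F W) else 0)
        + ∑ W : Submodule F V, if W ∈ End.invtSubmodule N ∧ v ∉ W then
          x ^ finrank F W * y ^ (finrank F V - finrank F W) else 0 := by
    rw [invariantSubspaceSum, ← Finset.sum_add_distrib]
    refine Finset.sum_congr rfl fun W _ => ?_
    by_cases h1 : W ∈ End.invtSubmodule N <;> by_cases h2 : v ∈ W <;> simp [h1, h2]
  have hquot : invariantSubspaceSum x y (quotientEnd N (Submodule.span F {v}))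
      = ∑ U : Submodule F V, if U ∈ End.invtSubmodule N ∧ v ∈ U then
          x ^ (finrank F U - 1) * y ^ (finrank F V - finrank F U) else 0 := by
    rw [invariantSubspaceSum_quotientEnd x y hL, hfrL]
    simp only [Submodule.span_singleton_le_iff_mem]
  have hmem : (∑ W : Submodule F V, if W ∈ End.invtSubmodule N ∧ v ∈ W then
          x ^ finrank F W * y ^ (finrank F V - finrank F W) else 0)
      = x * invariantSubspaceSum x y (quotientEnd N (Submodule.span F {v})) := by
    rw [hquot, Finset.mul_sum]
    refine Finset.sum_congr rfl fun W _ => ?_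
    split_ifs with h
    · obtain ⟨k, hk⟩ := Nat.exists_eq_add_of_le' (hpos h.2)
      rw [hk, Nat.add_sub_cancel, pow_succ]
      ring
    · simp
  have hnotMem : (∑ W : Submodule F V, if W ∈ End.invtSubmodule N ∧ v ∉ W then
          x ^ finrank F W * y ^ (finrank F V - finrank F W) else 0)
      = ∑ U : Submodule F V, if U ∈ End.invtSubmodule N ∧ v ∈ U then
          t U * (∑ W : Submodule F V,
            if W ∈ End.invtSubmodule N ∧ v ∉ W ∧ W ⊔ Submodule.span F {v} = U then 1 else 0)
          else 0 := by
    simp only [Finset.mul_sum]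
    have h1 (U : Submodule F V) : (if U ∈ End.invtSubmodule N ∧ v ∈ U then
          ∑ W : Submodule F V, t U *
            (if W ∈ End.invtSubmodule N ∧ v ∉ W ∧ W ⊔ Submodule.span F {v} = U then 1 else 0)
          else 0)
        = ∑ W : Submodule F V, if W ⊔ Submodule.span F {v} = U then
            (if W ∈ End.invtSubmodule N ∧ v ∉ W then t U else 0) else 0 := by
      split_ifs with h
      · refine Finset.sum_congr rfl fun W _ => ?_
        by_cases h1 : W ∈ End.invtSubmodule N <;> by_cases h2 : v ∈ W <;>
          by_cases h3 : W ⊔ Submodule.span F {v} = U <;> simp [h1, h2, h3]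
      · refine (Finset.sum_eq_zero fun W _ => ?_).symm
        split_ifs with h1 h2
        · refine absurd ⟨h1 ▸ ?_, h1 ▸ Submodule.mem_sup_right hvL⟩ h
          exact Sublattice.sup_mem h2.1 hL
        · rfl
        · rfl
    rw [Finset.sum_congr rfl fun U _ => h1 U, Finset.sum_comm]
    refine Finset.sum_congr rfl fun W _ => ?_
    rw [Finset.sum_ite_eq, if_pos (Finset.mem_univ _)]
    split_ifs with h
    · have h2 : finrank F (W ⊔ Submodule.span F {v} : Submodule F V) = finrank F W + 1 := by
        have h3 := Submodule.finrank_sup_add_finrank_inf_eq W (Submodule.span F {v})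
        have h4 : W ⊓ Submodule.span F {v} = ⊥ :=
          (Submodule.disjoint_span_singleton' hv0).2 h.2 |>.eq_bot
        rw [h4, finrank_bot, hfrL] at h3
        omega
      simp only [ht, h2, Nat.add_sub_cancel]
    · rfl
  have hcount (U : Submodule F V) (hU : U ∈ End.invtSubmodule N) (hvU : v ∈ U) :
      (∑ W : Submodule F V,
            if W ∈ End.invtSubmodule N ∧ v ∉ W ∧ W ⊔ Submodule.span F {v} = U then (1 : ℂ) else 0)
        = 1 + (Nat.card F : ℂ)⁻¹ * ∑ w : V,
          if w ∉ Submodule.span F {v} ∧ N w ∈ Submodule.span F {v} then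
            (if w ∈ U then ψ (δ (N w)) else 0) else 0 := by
    have h1 := card_mul_sum_complement_eq_sum hψ hv hδ hU hvU
    have h2 : (∑ w : V, if w ∈ U ∧ N w ∈ Submodule.span F {v} then ψ (δ (N w)) else 0)
        = (∑ w : V, if w ∈ Submodule.span F {v} then (1 : ℂ) else 0)
          + ∑ w : V, if w ∉ Submodule.span F {v} ∧ N w ∈ Submodule.span F {v} then
            (if w ∈ U then ψ (δ (N w)) else 0) else 0 := by
      rw [← Finset.sum_add_distrib]
      refine Finset.sum_congr rfl fun w _ => ?_
      by_cases hw : w ∈ Submodule.span F {v}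
      · have hwU : w ∈ U := (Submodule.span_singleton_le_iff_mem v U).2 hvU hw
        simp [hw, hwU, hNL w hw]
      · by_cases hwU : w ∈ U <;> simp [hw, hwU]
    have h3 : (∑ w : V, if w ∈ Submodule.span F {v} then (1 : ℂ) else 0) = Nat.card F := by
      rw [← Finset.natCast_card_filter, ← Fintype.card_subtype]
      have := Module.natCard_eq_pow_finrank (K := F) (V := Submodule.span F {v})
      rw [hfrL, pow_one] at this
      rw [← this, ← Nat.card_eq_fintype_card]
    rw [h2, h3] at h1
    rw [eq_comm, ← mul_right_inj' hq, h1]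
    field_simp
  have hplane (w : V) (hw : w ∉ Submodule.span F {v}) (hNw : N w ∈ Submodule.span F {v}) :
      x * y * invariantSubspaceSum x y (quotientEnd N (Submodule.span F {v, w}))
        = ∑ U : Submodule F V, if U ∈ End.invtSubmodule N ∧ v ∈ U then
            t U * (if w ∈ U then 1 else 0) else 0 := by
    have hP : Submodule.span F {v, w} ∈ End.invtSubmodule N := by
      intro u hu
      obtain ⟨c, d, rfl⟩ := Submodule.mem_span_pair.1 hu
      rw [Submodule.mem_comap, map_add, map_smul, map_smul, hv, smul_zero, zero_add]
      exact Submodule.smul_mem _ _ (Submodule.span_mono (by simp) hNw)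
    have hfrP : finrank F (Submodule.span F {v, w}) = 2 := by
      have hli : LinearIndependent F ![v, w] := by
        rw [LinearIndependent.pair_iff' hv0]
        exact fun c hc => hw (Submodule.mem_span_singleton.2 ⟨c, hc⟩)
      have := finrank_span_eq_card hli
      rwa [Matrix.range_cons, Matrix.range_cons, Matrix.range_empty, Set.union_empty] at this
    rw [invariantSubspaceSum_quotientEnd x y hP, hfrP, Finset.mul_sum]
    refine Finset.sum_congr rfl fun U _ => ?_
    have hPU : Submodule.span F {v, w} ≤ U ↔ v ∈ U ∧ w ∈ U := by
      rw [Submodule.span_le, Set.insert_subset_iff, Set.singleton_subset_iff]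
      rfl
    by_cases h : U ∈ End.invtSubmodule N ∧ v ∈ U ∧ w ∈ U
    · have h2 : 2 ≤ finrank F U := hfrP ▸ Submodule.finrank_mono (hPU.2 h.2)
      obtain ⟨k, hk⟩ := Nat.exists_eq_add_of_le' h2
      have h3 := hle U
      simp only [hPU, h.1, h.2.1, h.2.2, and_self, if_true, ht, hk]
      rw [show finrank F V - (k + 2 - 1) = (finrank F V - (k + 2)) + 1 by omega,
        show k + 2 - 1 = k + 1 by omega, Nat.add_sub_cancel]
      ring
    · rw [hPU, if_neg h, mul_zero]
      by_cases h1 : U ∈ End.invtSubmodule N ∧ v ∈ U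
      · have h2 : w ∉ U := fun h2 => h ⟨h1.1, h1.2, h2⟩
        simp [h2]
      · rw [if_neg h1]
  rw [hsplit, hmem, hnotMem, add_mul, add_assoc, add_right_inj]
  have hsum1 : y * invariantSubspaceSum x y (quotientEnd N (Submodule.span F {v}))
      = ∑ U : Submodule F V, if U ∈ End.invtSubmodule N ∧ v ∈ U then t U else 0 := by
    rw [hquot, Finset.mul_sum]
    refine Finset.sum_congr rfl fun U _ => ?_
    split_ifs with h
    · have h1 := hpos h.2
      have h2 := hle U
      simp only [ht]
      rw [show finrank F V - (finrank F U - 1) = (finrank F V - finrank F U) + 1 by omega]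
      ring
    · simp
  have hsum2 : x * y / Nat.card F * (∑ w : V,
          if w ∉ Submodule.span F {v} ∧ N w ∈ Submodule.span F {v} then
            ψ (δ (N w)) * invariantSubspaceSum x y (quotientEnd N (Submodule.span F {v, w}))
          else 0)
      = ∑ U : Submodule F V, if U ∈ End.invtSubmodule N ∧ v ∈ U then
          t U * ((Nat.card F : ℂ)⁻¹ * ∑ w : V,
            if w ∉ Submodule.span F {v} ∧ N w ∈ Submodule.span F {v} then
              (if w ∈ U then ψ (δ (N w)) else 0) else 0) else 0 := by
    have h1 (w : V) : x * y / Nat.card F *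
          (if w ∉ Submodule.span F {v} ∧ N w ∈ Submodule.span F {v} then
            ψ (δ (N w)) * invariantSubspaceSum x y (quotientEnd N (Submodule.span F {v, w}))
          else 0)
        = ∑ U : Submodule F V, if U ∈ End.invtSubmodule N ∧ v ∈ U then
            t U * ((Nat.card F : ℂ)⁻¹ *
              if w ∉ Submodule.span F {v} ∧ N w ∈ Submodule.span F {v} then
                (if w ∈ U then ψ (δ (N w)) else 0) else 0) else 0 := by
      split_ifs with h
      · have h2 := hplane w h.1 h.2
        rw [show x * y / Nat.card F * (ψ (δ (N w)) *
            invariantSubspaceSum x y (quotientEnd N (Submodule.span F {v, w})))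
          = (Nat.card F : ℂ)⁻¹ * ψ (δ (N w)) * (x * y *
            invariantSubspaceSum x y (quotientEnd N (Submodule.span F {v, w}))) by
              field_simp, h2, Finset.mul_sum]
        refine Finset.sum_congr rfl fun U _ => ?_
        split_ifs <;> ring
      · simp
    rw [Finset.mul_sum, Finset.sum_congr rfl fun w _ => h1 w, Finset.sum_comm]
    refine Finset.sum_congr rfl fun U _ => ?_
    split_ifs with h
    · rw [← Finset.mul_sum, ← Finset.mul_sum]
    · simp
  rw [hsum1, hsum2, ← Finset.sum_add_distrib]
  refine Finset.sum_congr rfl fun U _ => ?_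
  split_ifs with h
  · rw [hcount U h.1 h.2]
    ring
  · simp

end Count

/-! ### Evaluation of the Kloosterman sums -/

section Evaluation

theorem exists_apply_eq_zero_of_isNilpotent {F V : Type*} [Field F] [AddCommGroup V] [Module F V]
    [Nontrivial V] {N : End F V} (hN : IsNilpotent N) : ∃ v, v ≠ 0 ∧ N v = 0 := by
  by_contra! h
  have hinj : Function.Injective N := by
    rw [← LinearMap.ker_eq_bot, LinearMap.ker_eq_bot']
    intro v hv
    by_contra hv0
    exact h v hv0 hv
  obtain ⟨k, hk⟩ := hN
  have h1 : Function.Injective (N ^ k) := by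
    rw [End.coe_pow]
    exact hinj.iterate k
  obtain ⟨v, hv⟩ := exists_ne (0 : V)
  exact hv (h1 (by simp [hk]))

theorem exists_dual_apply_eq_one {F V : Type*} [Field F] [AddCommGroup V] [Module F V] {v : V}
    (hv : v ≠ 0) : ∃ δ : Dual F V, δ v = 1 := by
  obtain ⟨f, hf, -⟩ := Submodule.exists_le_ker_of_notMem (p := (⊥ : Submodule F V)) (v := v)
    (by simpa)
  exact ⟨(f v)⁻¹ • f, by simp [hf]⟩

/-- If `x + y` and `x y` are the coefficients of the `L`-function of the Kloosterman sum of `α`,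
then the Kloosterman sum of `α + N` is a sum over the `N`-invariant subspaces. -/
theorem endKloostermanSum_eq_invariantSubspaceSum {F : Type*} [Field F] [Fintype F] [DecidableEq F]
    {ψ : AddChar F ℂ} (hψ : ψ ≠ 1) {α : F} {x y : ℂ} (hadd : x + y = -kloostermanSum ψ α)
    (hmul : x * y = if α = 0 then 0 else (Nat.card F : ℂ)) (n : ℕ) {V : Type*} [AddCommGroup V]
    [Module F V] [Finite V] (hV : finrank F V = n) {N : End F V} (hN : IsNilpotent N) :
    endKloostermanSum ψ α N
      = (-1) ^ n * (Nat.card F : ℂ) ^ (n * (n - 1) / 2) * invariantSubspaceSum x y N := by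
  classical
  induction n using Nat.strong_induction_on generalizing V with
  | h n ih =>
  have hq : (Nat.card F : ℂ) ≠ 0 := by simp
  rcases Nat.eq_zero_or_pos n with rfl | hn
  · have : Subsingleton V := Module.finrank_zero_iff.1 hV
    have h1 : endKloostermanSum ψ α N = 1 := by
      rw [endKloostermanSum, Fintype.sum_subsingleton _ (LinearEquiv.refl F V), kloostermanTrace,
        Subsingleton.elim (α • (_ : V →ₗ[F] V) + _ + _) 0, map_zero, AddChar.map_zero_eq_one]
    have h2 : invariantSubspaceSum x y N = 1 := by
      rw [invariantSubspaceSum, Fintype.sum_subsingleton _ (⊥ : Submodule F V), hV]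
      rw [if_pos]
      · simp
      · rw [End.mem_invtSubmodule]
        exact bot_le
    simp [h1, h2]
  obtain ⟨m, rfl⟩ : ∃ m, n = m + 1 := ⟨n - 1, by omega⟩
  have : Nontrivial V := Module.nontrivial_of_finrank_pos (R := F) (by omega)
  obtain ⟨v, hv0, hv⟩ := exists_apply_eq_zero_of_isNilpotent hN
  obtain ⟨δ, hδ⟩ := exists_dual_apply_eq_one (F := F) hv0
  have hL : finrank F (V ⧸ Submodule.span F {v}) = m := by
    have h1 := (Submodule.span F {v}).finrank_quotient_add_finrank
    rw [finrank_span_singleton hv0] at h1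
    omega
  rw [endKloostermanSum_eq_sum_quotientEnd hψ α hv0 hv hδ,
    invariantSubspaceSum_eq_sum_quotientEnd hψ x y hv0 hv hδ, hadd,
    ih m (by omega) hL (isNilpotent_quotientEnd hN _), hmul, hV, mul_add, Finset.mul_sum,
    Finset.mul_sum, Nat.add_sub_cancel]
  congr 1
  · rw [show (m + 1) * m / 2 = m * (m - 1) / 2 + m from Nat.triangle_succ m, pow_add]
    ring
  · refine Finset.sum_congr rfl fun w _ => ?_
    by_cases hw : w ∉ Submodule.span F {v} ∧ N w ∈ Submodule.span F {v}
    swap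
    · rw [if_neg hw, if_neg hw, mul_zero, mul_zero]
    have hfrP : finrank F (Submodule.span F {v, w}) = 2 := by
      have hli : LinearIndependent F ![v, w] := by
        rw [LinearIndependent.pair_iff' hv0]
        exact fun c hc => hw.1 (Submodule.mem_span_singleton.2 ⟨c, hc⟩)
      have := finrank_span_eq_card hli
      rwa [Matrix.range_cons, Matrix.range_cons, Matrix.range_empty, Set.union_empty] at this
    have h1 := (Submodule.span F {v, w}).finrank_quotient_add_finrank
    obtain ⟨k, rfl⟩ : ∃ k, m = k + 1 := ⟨m - 1, by omega⟩
    rw [if_pos hw, if_pos hw, ih k (by omega) (by omega) (isNilpotent_quotientEnd hN _),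
      show (k + 1 + 1) * (k + 1) / 2 = (k + 1) * (k + 1 - 1) / 2 + (k + 1) from
        Nat.triangle_succ (k + 1), Nat.triangle_succ k,
      show 2 * (k + 1 + 1 - 2) = k + k by omega]
    simp only [pow_add, pow_one]
    field_simp

end Evaluation

/-! ### The `L`-function of a Kloosterman sum -/

section LFunction

open Polynomial

variable {F : Type*} [Field F]

open scoped Classical in
/-- The completely multiplicative function on monic polynomials `f` over `F` whose value is
`ψ (∑ (α r + r⁻¹))` with the sum over the roots `r` of `f`, and `0` if `0` is a root. -/
noncomputable def polyChar (ψ : AddChar F ℂ) (α : F) (f : F[X]) : ℂ :=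
  if f.coeff 0 = 0 then 0 else ψ (-(α * f.nextCoeff) - f.coeff 1 / f.coeff 0)

variable (ψ : AddChar F ℂ) (α : F)

theorem polyChar_one : polyChar ψ α 1 = 1 := by
  have h : (1 : F[X]).nextCoeff = 0 := by simpa using nextCoeff_C_eq_zero (1 : F)
  rw [polyChar, if_neg (by simp), h]
  simp [coeff_one]

theorem polyChar_mul {f g : F[X]} (hf : f.Monic) (hg : g.Monic) :
    polyChar ψ α (f * g) = polyChar ψ α f * polyChar ψ α g := by
  rw [polyChar, polyChar, polyChar, mul_coeff_zero, mul_coeff_one, hf.nextCoeff_mul hg]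
  by_cases h1 : f.coeff 0 = 0
  · simp [h1]
  by_cases h2 : g.coeff 0 = 0
  · simp [h2]
  rw [if_neg (mul_ne_zero h1 h2), if_neg h1, if_neg h2, ← AddChar.map_add_eq_mul]
  congr 1
  field_simp
  ring

theorem polyChar_pow {f : F[X]} (hf : f.Monic) (k : ℕ) :
    polyChar ψ α (f ^ k) = polyChar ψ α f ^ k := by
  induction k with
  | zero => simp [polyChar_one]
  | succ k ih => rw [pow_succ, pow_succ, polyChar_mul ψ α (hf.pow k) hf, ih]

variable (F) in
theorem finite_setOf_monic [Finite F] (n : ℕ) : {f : F[X] | f.Monic ∧ f.natDegree = n}.Finite := by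
  refine Set.Finite.of_injOn (f := fun f => fun i : Fin n => f.coeff i) (t := Set.univ)
    (Set.mapsTo_univ _ _) ?_ Set.finite_univ
  rintro f ⟨hf, rfl⟩ g ⟨hg, hfg⟩ h
  ext i
  rcases lt_trichotomy i f.natDegree with hi | rfl | hi
  · exact congrFun h ⟨i, hi⟩
  · rw [hf.coeff_natDegree, ← hfg, hg.coeff_natDegree]
  · rw [coeff_eq_zero_of_natDegree_lt hi, coeff_eq_zero_of_natDegree_lt (hfg ▸ hi)]

variable (F) in
/-- The monic polynomials of degree `n` over a finite field. -/
noncomputable def monicOfDegree [Finite F] (n : ℕ) : Finset F[X] :=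
  (finite_setOf_monic F n).toFinset

@[simp] theorem mem_monicOfDegree [Finite F] {n : ℕ} {f : F[X]} :
    f ∈ monicOfDegree F n ↔ f.Monic ∧ f.natDegree = n := by
  simp [monicOfDegree]

/-- The coefficient of `T ^ n` in the `L`-function `∑_f polyChar f * T ^ deg f`. -/
noncomputable def lCoeff [Finite F] (n : ℕ) : ℂ := ∑ f ∈ monicOfDegree F n, polyChar ψ α f

theorem lCoeff_zero [Finite F] : lCoeff ψ α 0 = 1 := by
  have : monicOfDegree F 0 = {1} := by
    ext f
    simp only [mem_monicOfDegree, Finset.mem_singleton]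
    constructor
    · rintro ⟨h1, h2⟩
      exact eq_one_of_monic_natDegree_zero h1 h2
    · rintro rfl
      simp
  rw [lCoeff, this, Finset.sum_singleton, polyChar_one]

theorem polyChar_X_add_C {c : F} (hc : c ≠ 0) : polyChar ψ α (X + C c) = ψ (-(α * c) - c⁻¹) := by
  rw [polyChar, nextCoeff_X_add_C]
  simp [hc]

theorem lCoeff_one [Fintype F] [DecidableEq F] : lCoeff ψ α 1 = kloostermanSum ψ α := by
  rw [lCoeff, kloostermanSum]
  have h1 : ∑ f ∈ monicOfDegree F 1, polyChar ψ α f = ∑ c : F, polyChar ψ α (X + C c) := by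
    have h2 (f : F[X]) (hf : f ∈ monicOfDegree F 1) : X + C (f.coeff 0) = f := by
      rw [mem_monicOfDegree] at hf
      ext i
      rcases i with _ | _ | i
      · simp
      · have := hf.1.coeff_natDegree
        rw [hf.2] at this
        simp [this]
      · rw [coeff_eq_zero_of_natDegree_lt (p := f) (n := i + 1 + 1) (by rw [hf.2]; omega)]
        simp [coeff_X]
    refine Finset.sum_nbij' (fun f => f.coeff 0) (fun c => X + C c) (by simp) ?_ h2 (by simp) ?_
    · intro c _
      simp [monic_X_add_C]
    · intro f hf
      rw [h2 f hf]
  rw [h1]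
  symm
  refine Fintype.sum_of_injective (fun x : Fˣ => -(x : F)) ?_ _ _ ?_ ?_
  · intro x y h
    exact Units.ext (neg_injective h)
  · intro c hc
    have : c = 0 := by
      by_contra h
      exact hc ⟨-Units.mk0 c h, by simp⟩
    rw [this, polyChar]
    simp
  · intro x
    rw [polyChar_X_add_C ψ α (neg_ne_zero.2 x.ne_zero)]
    congr 1
    rw [Units.val_inv_eq_inv_val, inv_neg]
    ring

theorem coeff_zero_X_sq_add (a b : F) : (X ^ 2 + C a * X + C b : F[X]).coeff 0 = b := by
  simp

theorem coeff_one_X_sq_add (a b : F) : (X ^ 2 + C a * X + C b : F[X]).coeff 1 = a := by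
  simp [coeff_X_pow, coeff_C]

theorem natDegree_X_sq_add (a b : F) : (X ^ 2 + C a * X + C b : F[X]).natDegree = 2 := by
  compute_degree!

/-- The sum over the coefficient `a` of `X ^ 2 + a X + b` vanishes unless `α + b⁻¹ = 0`. -/
theorem lCoeff_two [Finite F] [DecidableEq F] (hψ : ψ ≠ 1) :
    lCoeff ψ α 2 = if α = 0 then 0 else (Nat.card F : ℂ) := by
  have h1 : lCoeff ψ α 2 = ∑ p : F × F, polyChar ψ α (X ^ 2 + C p.1 * X + C p.2) := by
    have h2 (f : F[X]) (hf : f ∈ monicOfDegree F 2) :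
        X ^ 2 + C (f.coeff 1) * X + C (f.coeff 0) = f := by
      rw [mem_monicOfDegree] at hf
      ext i
      rcases i with _ | _ | _ | i
      · simp
      · simp [coeff_X_pow, coeff_C]
      · have := hf.1.coeff_natDegree
        rw [hf.2] at this
        simp [this]
      · rw [coeff_eq_zero_of_natDegree_lt (p := f) (n := i + 1 + 1 + 1) (by rw [hf.2]; omega)]
        simp [coeff_X_pow]
    refine Finset.sum_nbij' (fun f => (f.coeff 1, f.coeff 0))
      (fun p => X ^ 2 + C p.1 * X + C p.2) (by simp) ?_ h2 ?_ ?_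
    · intro p _
      rw [mem_monicOfDegree]
      refine ⟨?_, natDegree_X_sq_add _ _⟩
      monicity!
    · intro p _
      rw [coeff_zero_X_sq_add, coeff_one_X_sq_add]
    · intro f hf
      rw [h2 f hf]
  have h2 (p : F × F) : polyChar ψ α (X ^ 2 + C p.1 * X + C p.2)
      = if p.2 = 0 then 0 else ψ (LinearMap.mulRight F (-(α + p.2⁻¹)) p.1) := by
    rw [polyChar, nextCoeff_of_natDegree_pos (by rw [natDegree_X_sq_add]; norm_num),
      natDegree_X_sq_add, show 2 - 1 = 1 from rfl, coeff_zero_X_sq_add, coeff_one_X_sq_add]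
    by_cases h : p.2 = 0
    · rw [if_pos h, if_pos h]
    · rw [if_neg h, if_neg h, LinearMap.mulRight_apply]
      congr 1
      ring
  rw [h1, Fintype.sum_prod_type_right]
  have h3 (b : F) : ∑ a : F, polyChar ψ α (X ^ 2 + C a * X + C b)
      = if b = -α⁻¹ then (if α = 0 then 0 else (Nat.card F : ℂ)) else 0 := by
    by_cases hb : b = 0
    · have e : (∑ a : F, polyChar ψ α (X ^ 2 + C a * X + C b)) = 0 :=
        Finset.sum_eq_zero fun a _ => by rw [h2 (a, b), if_pos hb]
      rw [e]
      split_ifs with h4 h5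
      · rfl
      · rw [hb, eq_comm, neg_eq_zero, inv_eq_zero] at h4
        exact absurd h4 h5
      · rfl
    · have e : (∑ a : F, polyChar ψ α (X ^ 2 + C a * X + C b))
          = ∑ a : F, ψ (LinearMap.mulRight F (-(α + b⁻¹)) a) :=
        Finset.sum_congr rfl fun a _ => by rw [h2 (a, b), if_neg hb]
      have h5 : LinearMap.mulRight F (-(α + b⁻¹)) = 0 ↔ b = -α⁻¹ := by
        rw [LinearMap.mulRight_eq_zero_iff, neg_eq_zero, add_eq_zero_iff_eq_neg, eq_comm,
          neg_eq_iff_eq_neg, inv_eq_iff_eq_inv, inv_neg]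
      rw [e, sum_addChar_comp_linearMap hψ]
      simp only [h5]
      split_ifs with h4 h6
      · rw [h6] at h4
        simp at h4
        exact absurd h4 hb
      · rfl
      · rfl
  simp only [h3, Finset.sum_ite_eq', Finset.mem_univ, if_true]

/-- For `n ≥ 3` the coefficient of `X` of a monic polynomial of degree `n` varies independently of
the constant coefficient and the next-to-leading one, so that the sum over it vanishes. -/
theorem lCoeff_eq_zero [Finite F] (hψ : ψ ≠ 1) {n : ℕ} (hn : 3 ≤ n) : lCoeff ψ α n = 0 := by
  classical
  have hdeg {f : F[X]} (hf : f.Monic ∧ f.natDegree = n) (t : F) :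
      (C t * X : F[X]).degree < f.degree := by
    rw [degree_eq_natDegree hf.1.ne_zero, hf.2]
    refine (degree_C_mul_X_le t).trans_lt ?_
    exact_mod_cast (by omega : 1 < n)
  have hmem {f : F[X]} (hf : f ∈ monicOfDegree F n) (t : F) : f + C t * X ∈ monicOfDegree F n := by
    rw [mem_monicOfDegree] at hf ⊢
    refine ⟨hf.1.add_of_left (hdeg hf t), ?_⟩
    rw [natDegree_eq_of_degree_eq (degree_add_eq_left_of_degree_lt (hdeg hf t)), hf.2]
  rw [lCoeff, ← Finset.sum_coe_sort]
  rw [sum_eq_sum_ite_of_twist hψ (A := F) _ (fun t =>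
    { toFun := fun f => ⟨f.1 + C t * X, hmem f.2 t⟩
      invFun := fun f => ⟨f.1 + C (-t) * X, hmem f.2 (-t)⟩
      left_inv := fun f => Subtype.ext (by simp)
      right_inv := fun f => Subtype.ext (by simp) })
    (fun f => LinearMap.mulRight F (-(f.1.coeff 0)⁻¹))]
  · refine Finset.sum_eq_zero fun f _ => ?_
    refine ite_eq_right_iff.2 fun h => if_pos ?_
    rwa [LinearMap.mulRight_eq_zero_iff, neg_eq_zero, inv_eq_zero] at h
  · intro t f
    have hf := f.2
    have hf' := hmem f.2 t
    rw [mem_monicOfDegree] at hf hf'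
    have e0 : (f.1 + C t * X).coeff 0 = f.1.coeff 0 := by simp
    have e1 : (f.1 + C t * X).coeff 1 = f.1.coeff 1 + t := by simp
    have e2 : (f.1 + C t * X).nextCoeff = f.1.nextCoeff := by
      rw [nextCoeff_of_natDegree_pos (by omega), nextCoeff_of_natDegree_pos (by omega), hf'.2, hf.2,
        coeff_add, coeff_C_mul_X, if_neg (by omega), add_zero]
    change polyChar ψ α (f.1 + C t * X) = _
    rw [polyChar, polyChar, e0, e1, e2]
    split_ifs with h
    · simp
    · rw [← AddChar.map_add_eq_mul, LinearMap.mulRight_apply]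
      congr 1
      field_simp
      ring

/-! ### Newton's identities from unique factorization -/

variable (F) in
open scoped Classical in
/-- The monic irreducible polynomials of degree `d` over a finite field. -/
noncomputable def irreducibleOfDegree [Finite F] (d : ℕ) : Finset F[X] :=
  {P ∈ monicOfDegree F d | Irreducible P}

@[simp] theorem mem_irreducibleOfDegree [Finite F] {d : ℕ} {P : F[X]} :
    P ∈ irreducibleOfDegree F d ↔ (P.Monic ∧ P.natDegree = d) ∧ Irreducible P := by
  simp [irreducibleOfDegree]

open scoped Classical in
/-- The degree of a monic polynomial counts, weighted by degree, the powers of monic irreducible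
polynomials that divide it. -/
theorem sum_pow_dvd_eq [Finite F] {m : ℕ} {f : F[X]} (hf : f ∈ monicOfDegree F m) :
    (∑ d ∈ Finset.Icc 1 m, ∑ P ∈ irreducibleOfDegree F d, ∑ k ∈ Finset.Icc 1 m,
      if P ^ k ∣ f then d else 0) = m := by
  rw [mem_monicOfDegree] at hf
  have hf0 : f ≠ 0 := hf.1.ne_zero
  set s := UniqueFactorizationMonoid.normalizedFactors f with hs
  have hirr {P : F[X]} (hP : P ∈ s) : Irreducible P :=
    UniqueFactorizationMonoid.irreducible_of_normalized_factor P hP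
  have hmon {P : F[X]} (hP : P ∈ s) : P.Monic :=
    (normalize_eq_self_iff_monic (hirr hP).ne_zero).1
      (UniqueFactorizationMonoid.normalize_normalized_factor P hP)
  have hdvd {P : F[X]} (hP : P ∈ s) : P ∣ f :=
    UniqueFactorizationMonoid.dvd_of_mem_normalizedFactors hP
  have hle {P : F[X]} (hP : P ∈ s) : P.natDegree ≤ m := hf.2 ▸ natDegree_le_of_dvd (hdvd hP) hf0
  have hpow {P : F[X]} (hP : P.Monic) (hPi : Irreducible P) (k : ℕ) :
      P ^ k ∣ f ↔ k ≤ s.count P := by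
    rw [pow_dvd_iff_le_emultiplicity,
      UniqueFactorizationMonoid.emultiplicity_eq_count_normalizedFactors hPi hf0,
      hP.normalize_eq_self, Nat.cast_le]
  have hprod : m = (s.map natDegree).sum := by
    rw [← natDegree_multiset_prod_of_monic s fun P hP => hmon hP, hs,
      UniqueFactorizationMonoid.prod_normalizedFactors_eq hf0, hf.1.normalize_eq_self, hf.2]
  have hcount (P : F[X]) : s.count P ≤ m := by
    by_cases hP : P ∈ s
    · have h1 : P ^ s.count P ∣ f := (hpow (hmon hP) (hirr hP) _).2 le_rfl
      have h2 := natDegree_le_of_dvd h1 hf0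
      rw [natDegree_pow, hf.2] at h2
      exact (Nat.le_mul_of_pos_right _ (hirr hP).natDegree_pos).trans h2
    · rw [Multiset.count_eq_zero_of_notMem hP]
      exact m.zero_le
  have hsum {d : ℕ} {P : F[X]} (hP : P ∈ irreducibleOfDegree F d) :
      (∑ k ∈ Finset.Icc 1 m, if P ^ k ∣ f then d else 0) = s.count P * d := by
    rw [mem_irreducibleOfDegree] at hP
    have h1 : {k ∈ Finset.Icc 1 m | P ^ k ∣ f} = Finset.Icc 1 (s.count P) := by
      ext k
      rw [Finset.mem_filter, hpow hP.1.1 hP.2, Finset.mem_Icc, Finset.mem_Icc]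
      have := hcount P
      omega
    rw [← Finset.sum_filter, h1]
    simp
  calc _ = ∑ d ∈ Finset.Icc 1 m, ∑ P ∈ s.toFinset with P.natDegree = d,
        s.count P * P.natDegree := by
        refine Finset.sum_congr rfl fun d _ => ?_
        rw [Finset.sum_congr rfl fun P hP => hsum hP]
        symm
        refine Finset.sum_subset_zero_on_sdiff ?_ ?_ ?_
        · intro P hP
          rw [Finset.mem_filter, Multiset.mem_toFinset] at hP
          exact mem_irreducibleOfDegree.2 ⟨⟨hmon hP.1, hP.2⟩, hirr hP.1⟩
        · intro P hP
          rw [Finset.mem_sdiff, Finset.mem_filter, mem_irreducibleOfDegree,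
            Multiset.mem_toFinset] at hP
          rw [Multiset.count_eq_zero_of_notMem fun h => hP.2 ⟨h, hP.1.1.2⟩, zero_mul]
        · intro P hP
          rw [(Finset.mem_filter.1 hP).2]
    _ = ∑ P ∈ s.toFinset, s.count P * P.natDegree := by
        refine Finset.sum_fiberwise_of_maps_to (fun P hP => ?_) _
        rw [Multiset.mem_toFinset] at hP
        exact Finset.mem_Icc.2 ⟨(hirr hP).natDegree_pos, hle hP⟩
    _ = m := by
        conv_rhs => rw [hprod, Finset.sum_multiset_map_count]
        simp

/-- The power sums attached to the `L`-function of a Kloosterman sum: the coefficient of `T ^ j` in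
its logarithmic derivative, expressed through the Euler product. -/
noncomputable def primeSum [Finite F] (j : ℕ) : ℂ :=
  ∑ p ∈ j.divisorsAntidiagonal, ∑ P ∈ irreducibleOfDegree F p.1, p.1 * polyChar ψ α P ^ p.2

open scoped Classical in
/-- Division by `P ^ k` reduces the sum over the multiples of `P ^ k` to a lower coefficient. -/
theorem sum_polyChar_pow_dvd [Finite F] {m d k : ℕ} {P : F[X]}
    (hP : P ∈ irreducibleOfDegree F d) :
    (∑ f ∈ monicOfDegree F m, if P ^ k ∣ f then polyChar ψ α f else 0)
      = if d * k ≤ m then polyChar ψ α P ^ k * lCoeff ψ α (m - d * k) else 0 := by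
  rw [mem_irreducibleOfDegree] at hP
  have hPk : (P ^ k).Monic := hP.1.1.pow k
  have hdeg : (P ^ k).natDegree = d * k := by rw [natDegree_pow, hP.1.2, mul_comm]
  split_ifs with h
  · rw [lCoeff, Finset.mul_sum, ← Finset.sum_filter]
    symm
    refine Finset.sum_nbij (fun g => P ^ k * g) ?_ ?_ ?_ ?_
    · intro g hg
      rw [mem_monicOfDegree] at hg
      rw [Finset.mem_filter, mem_monicOfDegree, hPk.natDegree_mul hg.1, hdeg, hg.2]
      exact ⟨⟨hPk.mul hg.1, by omega⟩, dvd_mul_right _ _⟩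
    · intro g _ g' _ hgg
      exact mul_left_cancel₀ hPk.ne_zero hgg
    · rintro f hf
      rw [Finset.mem_coe, Finset.mem_filter, mem_monicOfDegree] at hf
      obtain ⟨⟨hf1, hf2⟩, g, rfl⟩ := hf
      have hg : g.Monic := hPk.of_mul_monic_left hf1
      refine ⟨g, ?_, rfl⟩
      rw [hPk.natDegree_mul hg, hdeg] at hf2
      rw [Finset.mem_coe, mem_monicOfDegree]
      exact ⟨hg, by omega⟩
    · intro g hg
      rw [mem_monicOfDegree] at hg
      rw [polyChar_mul ψ α hPk hg.1, polyChar_pow ψ α hP.1.1]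
  · refine Finset.sum_eq_zero fun f hf => if_neg fun hd => h ?_
    rw [mem_monicOfDegree] at hf
    rw [← hdeg, ← hf.2]
    exact natDegree_le_of_dvd hd hf.1.ne_zero

theorem primeSum_eq_sum_Icc [Finite F] {m j : ℕ} (hj : j ∈ Finset.Icc 1 m) :
    primeSum ψ α j = ∑ d ∈ Finset.Icc 1 m, ∑ P ∈ irreducibleOfDegree F d,
      ∑ k ∈ Finset.Icc 1 m, if d * k = j then d * polyChar ψ α P ^ k else 0 := by
  have h1 : j.divisorsAntidiagonal
      = {p ∈ Finset.Icc 1 m ×ˢ Finset.Icc 1 m | p.1 * p.2 = j} := by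
    ext ⟨d, k⟩
    rw [Finset.mem_Icc] at hj
    rw [Nat.mem_divisorsAntidiagonal, Finset.mem_filter, Finset.mem_product, Finset.mem_Icc,
      Finset.mem_Icc]
    constructor
    · rintro ⟨rfl, h0⟩
      have hd : 0 < d := Nat.pos_of_ne_zero fun h => h0 (by simp [h])
      have hk : 0 < k := Nat.pos_of_ne_zero fun h => h0 (by simp [h])
      have h2 := Nat.le_mul_of_pos_right d hk
      have h3 := Nat.le_mul_of_pos_left k hd
      exact ⟨⟨⟨hd, by simp only at *; omega⟩, hk, by simp only at *; omega⟩, rfl⟩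
    · rintro ⟨-, rfl⟩
      exact ⟨rfl, by omega⟩
  rw [primeSum, h1, Finset.sum_filter, Finset.sum_product]
  refine Finset.sum_congr rfl fun d _ => ?_
  rw [Finset.sum_comm]
  refine Finset.sum_congr rfl fun k _ => ?_
  split_ifs <;> simp

/-- Newton's identities, relating the coefficients of the `L`-function to the sums over prime
powers. -/
theorem natCast_mul_lCoeff_eq_sum [Finite F] (m : ℕ) :
    m * lCoeff ψ α m = ∑ j ∈ Finset.Icc 1 m, primeSum ψ α j * lCoeff ψ α (m - j) := by
  classical
  calc m * lCoeff ψ α m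
      = ∑ f ∈ monicOfDegree F m, ∑ d ∈ Finset.Icc 1 m, ∑ P ∈ irreducibleOfDegree F d,
          ∑ k ∈ Finset.Icc 1 m, d * (if P ^ k ∣ f then polyChar ψ α f else 0) := by
        rw [lCoeff, Finset.mul_sum]
        refine Finset.sum_congr rfl fun f hf => ?_
        conv_lhs => rw [← sum_pow_dvd_eq hf]
        push_cast
        simp only [Finset.sum_mul]
        refine Finset.sum_congr rfl fun d _ => Finset.sum_congr rfl fun P _ =>
          Finset.sum_congr rfl fun k _ => ?_
        split_ifs <;> simp
    _ = ∑ d ∈ Finset.Icc 1 m, ∑ P ∈ irreducibleOfDegree F d, ∑ k ∈ Finset.Icc 1 m,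
          d * (if d * k ≤ m then polyChar ψ α P ^ k * lCoeff ψ α (m - d * k) else 0) := by
        rw [Finset.sum_comm]
        refine Finset.sum_congr rfl fun d _ => ?_
        rw [Finset.sum_comm]
        refine Finset.sum_congr rfl fun P hP => ?_
        rw [Finset.sum_comm]
        refine Finset.sum_congr rfl fun k _ => ?_
        rw [← Finset.mul_sum, sum_polyChar_pow_dvd ψ α hP]
    _ = ∑ d ∈ Finset.Icc 1 m, ∑ P ∈ irreducibleOfDegree F d, ∑ k ∈ Finset.Icc 1 m,
          ∑ j ∈ Finset.Icc 1 m,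
            (if d * k = j then d * polyChar ψ α P ^ k else 0) * lCoeff ψ α (m - j) := by
        refine Finset.sum_congr rfl fun d hd => Finset.sum_congr rfl fun P _ =>
          Finset.sum_congr rfl fun k hk => ?_
        simp only [ite_mul, zero_mul]
        rw [Finset.sum_ite_eq]
        have h1 : d * k ∈ Finset.Icc 1 m ↔ d * k ≤ m := by
          rw [Finset.mem_Icc] at hd hk ⊢
          have := Nat.mul_pos hd.1 hk.1
          omega
        simp only [h1]
        split_ifs <;> ring
    _ = _ := by
        have h1 : ∀ j ∈ Finset.Icc 1 m, primeSum ψ α j * lCoeff ψ α (m - j)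
            = ∑ d ∈ Finset.Icc 1 m, ∑ P ∈ irreducibleOfDegree F d, ∑ k ∈ Finset.Icc 1 m,
              (if d * k = j then d * polyChar ψ α P ^ k else 0) * lCoeff ψ α (m - j) := by
          intro j hj
          rw [primeSum_eq_sum_Icc ψ α hj]
          simp only [Finset.sum_mul]
        rw [Finset.sum_congr rfl h1]
        symm
        rw [Finset.sum_comm]
        refine Finset.sum_congr rfl fun d _ => ?_
        rw [Finset.sum_comm]
        refine Finset.sum_congr rfl fun P _ => ?_
        rw [Finset.sum_comm]

end LFunction

/-! ### Kloosterman sums over extension fields -/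

section Extension

open Polynomial

section Trace

variable {F E : Type*} [Field F] [Field E] [Algebra F E] [FiniteDimensional F E]

theorem coeff_zero_minpoly_ne_zero {x : E} (hx : x ≠ 0) : (minpoly F x).coeff 0 ≠ 0 :=
  minpoly.coeff_zero_ne_zero (Algebra.IsIntegral.isIntegral x) hx

theorem natDegree_reverse_of_coeff_zero_ne_zero {p : F[X]} (hp : p.coeff 0 ≠ 0) :
    p.reverse.natDegree = p.natDegree := by
  rw [reverse_natDegree, natTrailingDegree_eq_zero.2 (Or.inr hp), Nat.sub_zero]

theorem natDegree_minpoly_inv_le {x : E} (hx : x ≠ 0) :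
    (minpoly F x⁻¹).natDegree ≤ (minpoly F x).natDegree := by
  have h0 := coeff_zero_minpoly_ne_zero (F := F) hx
  rw [← natDegree_reverse_of_coeff_zero_ne_zero h0]
  have : Invertible x := invertibleOfNonzero hx
  have h1 : aeval x⁻¹ (minpoly F x).reverse = 0 := by
    rw [← invOf_eq_inv x, aeval_def, eval₂_reverse_eq_zero_iff, ← aeval_def, minpoly.aeval]
  refine natDegree_le_of_dvd (minpoly.dvd F _ h1) ?_
  rw [Ne, reverse_eq_zero]
  exact minpoly.ne_zero (Algebra.IsIntegral.isIntegral x)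

theorem natDegree_minpoly_inv {x : E} (hx : x ≠ 0) :
    (minpoly F x⁻¹).natDegree = (minpoly F x).natDegree := by
  refine le_antisymm (natDegree_minpoly_inv_le hx) ?_
  conv_lhs => rw [← inv_inv x]
  exact natDegree_minpoly_inv_le (inv_ne_zero hx)

theorem minpoly_inv_eq {x : E} (hx : x ≠ 0) :
    minpoly F x⁻¹ = C ((minpoly F x).coeff 0)⁻¹ * (minpoly F x).reverse := by
  have h0 := coeff_zero_minpoly_ne_zero (F := F) hx
  have hlead : (minpoly F x).reverse.leadingCoeff = (minpoly F x).coeff 0 := by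
    rw [reverse_leadingCoeff, trailingCoeff, natTrailingDegree_eq_zero.2 (Or.inr h0)]
  have hmon : (C ((minpoly F x).coeff 0)⁻¹ * (minpoly F x).reverse).Monic := by
    rw [Monic, leadingCoeff_mul, leadingCoeff_C, hlead, inv_mul_cancel₀ h0]
  have : Invertible x := invertibleOfNonzero hx
  have h1 : aeval x⁻¹ (minpoly F x).reverse = 0 := by
    rw [← invOf_eq_inv x, aeval_def, eval₂_reverse_eq_zero_iff, ← aeval_def, minpoly.aeval]
  symm
  refine eq_of_monic_of_dvd_of_natDegree_le
    (minpoly.monic (Algebra.IsIntegral.isIntegral x⁻¹)) hmon ((minpoly.dvd F _ h1).mul_left _) ?_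
  rw [natDegree_C_mul (inv_ne_zero h0), natDegree_reverse_of_coeff_zero_ne_zero h0,
    natDegree_minpoly_inv hx]

theorem nextCoeff_minpoly_inv {x : E} (hx : x ≠ 0) :
    (minpoly F x⁻¹).nextCoeff = (minpoly F x).coeff 1 / (minpoly F x).coeff 0 := by
  have hpos : 0 < (minpoly F x).natDegree :=
    minpoly.natDegree_pos (Algebra.IsIntegral.isIntegral x)
  rw [nextCoeff_of_natDegree_pos (by rwa [natDegree_minpoly_inv hx]), natDegree_minpoly_inv hx,
    minpoly_inv_eq hx, coeff_C_mul, coeff_reverse, revAt_le (Nat.sub_le _ _),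
    Nat.sub_sub_self hpos, div_eq_inv_mul]

theorem natDegree_minpoly_mul_eq (x : E) :
    (minpoly F x).natDegree * finrank (IntermediateField.adjoin F {x}) E = finrank F E := by
  rw [← IntermediateField.adjoin.finrank (Algebra.IsIntegral.isIntegral x)]
  exact finrank_mul_finrank F _ E

theorem finrank_adjoin_inv {x : E} (hx : x ≠ 0) :
    finrank (IntermediateField.adjoin F {x⁻¹}) E = finrank (IntermediateField.adjoin F {x}) E := by
  have h1 := natDegree_minpoly_mul_eq (F := F) x
  have h2 := natDegree_minpoly_mul_eq (F := F) x⁻¹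
  rw [natDegree_minpoly_inv hx, ← h1] at h2
  exact Nat.eq_of_mul_eq_mul_left (minpoly.natDegree_pos (Algebra.IsIntegral.isIntegral x)) h2

/-- The traces of `x` and `x⁻¹` are read off from the minimal polynomial of `x`, each of whose roots
occurs `[E : F(x)]` times among the conjugates of `x`. -/
theorem extendChar_apply_eq_polyChar_pow {F : Type*} [Field F] (ψ : AddChar F ℂ) (α : F)
    {E : Type _} [Field E] [Algebra F E] [FiniteDimensional F E] {x : E} (hx : x ≠ 0) :
    extendChar ψ E (algebraMap F E α * x + x⁻¹)
      = polyChar ψ α (minpoly F x) ^ finrank (IntermediateField.adjoin F {x}) E := by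
  have h0 := coeff_zero_minpoly_ne_zero (F := F) hx
  change ψ (Algebra.trace F E (algebraMap F E α * x + x⁻¹)) = _
  rw [polyChar, if_neg h0, ← AddChar.map_nsmul_eq_pow, map_add, ← Algebra.smul_def, map_smul,
    trace_eq_finrank_mul_minpoly_nextCoeff F x, trace_eq_finrank_mul_minpoly_nextCoeff F x⁻¹,
    finrank_adjoin_inv hx, nextCoeff_minpoly_inv hx, nsmul_eq_mul, smul_eq_mul]
  congr 1
  ring

end Trace

open scoped Classical in
/-- A monic irreducible polynomial whose degree divides the degree of a finite extension has exactly
as many roots there as its degree. -/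
theorem card_minpoly_eq {F E : Type*} [Field F] [Finite F] [Field E] [Fintype E] [Algebra F E]
    {P : F[X]} (hP : P.Monic) (hPi : Irreducible P) (hd : P.natDegree ∣ finrank F E) :
    ({x : E | minpoly F x = P} : Finset E).card = P.natDegree := by
  have hsplit : (P.map (algebraMap F E)).Splits := by
    have h1 := hPi.natDegree_dvd_iff_dvd_X_pow_card_pow_sub_X.1 hd
    rw [← Module.natCard_eq_pow_finrank, Nat.card_eq_fintype_card] at h1
    have h2 := (FiniteField.isSplittingField_sub E F).splits
    refine Splits.of_dvd h2 ?_ (map_dvd (mapRingHom (algebraMap F E)) h1)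
    rw [Polynomial.map_sub, Polynomial.map_pow, map_X]
    exact FiniteField.X_pow_card_sub_X_ne_zero E Fintype.one_lt_card
  have hsep : P.Separable := PerfectField.separable_of_irreducible hPi
  rw [← card_rootSet_eq_natDegree hsep hsplit, ← Set.toFinset_card]
  congr 1
  ext x
  rw [Finset.mem_filter_univ, Set.mem_toFinset, mem_rootSet]
  constructor
  · rintro rfl
    exact ⟨hP.ne_zero, minpoly.aeval F x⟩
  · rintro ⟨-, hx⟩
    exact (minpoly.eq_of_irreducible_of_monic hPi hx hP).symm

universe w

open scoped Classical in
/-- The Kloosterman sum over an extension of degree `j`, sorted by minimal polynomials, is the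
`j`-th power sum. -/
theorem kloostermanSum_extendChar_eq_primeSum {F : Type w} [Field F] [Finite F] (ψ : AddChar F ℂ)
    (α : F) (E : Type w) [Field E] [Fintype E] [DecidableEq E] [Algebra F E] :
    kloostermanSum (extendChar ψ E) (algebraMap F E α) = primeSum ψ α (finrank F E) := by
  have hfin : FiniteDimensional F E := Module.Finite.of_finite
  have hpos : 0 < finrank F E := finrank_pos
  have h1 : kloostermanSum (extendChar ψ E) (algebraMap F E α) = ∑ x : E,
      polyChar ψ α (minpoly F x) ^ finrank (IntermediateField.adjoin F {x}) E := by
    rw [kloostermanSum]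
    refine Fintype.sum_of_injective (fun x : Eˣ => (x : E)) Units.val_injective _ _ ?_ ?_
    · intro x hx
      have hx0 : x = 0 := by
        by_contra h
        exact hx ⟨Units.mk0 x h, rfl⟩
      have h2 : polyChar ψ α (minpoly F x) = 0 := by
        rw [hx0, minpoly.zero, polyChar]
        simp
      have h3 : 0 < finrank (IntermediateField.adjoin F {x}) E := finrank_pos
      rw [h2, zero_pow h3.ne']
    · intro x
      rw [Units.val_inv_eq_inv_val]
      exact extendChar_apply_eq_polyChar_pow ψ α x.ne_zero
  have h2 : ∀ x : E, (∑ p ∈ (finrank F E).divisorsAntidiagonal, ∑ P ∈ irreducibleOfDegree F p.1,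
        if minpoly F x = P then polyChar ψ α P ^ p.2 else 0)
      = polyChar ψ α (minpoly F x) ^ finrank (IntermediateField.adjoin F {x}) E := by
    intro x
    have hx : IsIntegral F x := Algebra.IsIntegral.isIntegral x
    have hm := natDegree_minpoly_mul_eq (F := F) x
    rw [Finset.sum_eq_single
      ((minpoly F x).natDegree, finrank (IntermediateField.adjoin F {x}) E)]
    · rw [Finset.sum_ite_eq, if_pos]
      exact mem_irreducibleOfDegree.2 ⟨⟨minpoly.monic hx, rfl⟩, minpoly.irreducible hx⟩
    · rintro ⟨d, k⟩ hp hne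
      rw [Nat.mem_divisorsAntidiagonal] at hp
      refine Finset.sum_eq_zero fun P hP => if_neg ?_
      rintro rfl
      rw [mem_irreducibleOfDegree] at hP
      refine hne (Prod.ext hP.1.2.symm ?_)
      have h3 : d * k = d * finrank (IntermediateField.adjoin F {x}) E := by
        rw [hp.1, ← hm, hP.1.2]
      refine Nat.eq_of_mul_eq_mul_left ?_ h3
      exact Nat.pos_of_ne_zero fun h => hp.2 (by rw [← hp.1]; simp [h])
    · intro h
      exact absurd (Nat.mem_divisorsAntidiagonal.2 ⟨hm, hpos.ne'⟩) h
  rw [h1, ← Finset.sum_congr rfl fun x _ => h2 x, Finset.sum_comm, primeSum]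
  refine Finset.sum_congr rfl fun p hp => ?_
  rw [Finset.sum_comm]
  refine Finset.sum_congr rfl fun P hP => ?_
  rw [mem_irreducibleOfDegree] at hP
  rw [Nat.mem_divisorsAntidiagonal] at hp
  rw [← Finset.sum_filter, Finset.sum_const, nsmul_eq_mul]
  congr 2
  have h4 := card_minpoly_eq (E := E) hP.1.1 hP.2 (hP.1.2 ▸ Dvd.intro _ hp.1)
  rw [hP.1.2] at h4
  convert h4

/-- The coefficients `1`, `K(α)`, `S` and `0, 0, …` of the `L`-function and Newton's identities
show that the power sums are those of the inverse roots of `1 + K(α) T + S T ^ 2`. -/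
theorem primeSum_eq_neg_pow_add_pow {F : Type*} [Field F] [Fintype F] [DecidableEq F]
    {ψ : AddChar F ℂ} (hψ : ψ ≠ 1) {α : F} {x y : ℂ} (hadd : x + y = -kloostermanSum ψ α)
    (hmul : x * y = if α = 0 then 0 else (Nat.card F : ℂ)) (n : ℕ) (hn : 0 < n) :
    primeSum ψ α n = -(x ^ n + y ^ n) := by
  have e1 : primeSum ψ α 1 = -(x + y) := by
    have := natCast_mul_lCoeff_eq_sum ψ α 1
    simp only [Nat.cast_one, one_mul, Finset.Icc_self, Finset.sum_singleton, Nat.sub_self,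
      lCoeff_zero, mul_one, lCoeff_one] at this
    rw [← this, hadd, neg_neg]
  have hS1 : lCoeff ψ α 1 = -(x + y) := by rw [lCoeff_one, hadd, neg_neg]
  have hS2 : lCoeff ψ α 2 = x * y := by rw [lCoeff_two ψ α hψ, hmul]
  have e2 : primeSum ψ α 2 = -(x ^ 2 + y ^ 2) := by
    have := natCast_mul_lCoeff_eq_sum ψ α 2
    rw [Finset.sum_Icc_succ_top (by norm_num), Finset.Icc_self, Finset.sum_singleton] at this
    norm_num [hS2, hS1, e1, lCoeff_zero] at this
    linear_combination -this
  induction n using Nat.strong_induction_on with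
  | h n ih =>
  obtain rfl | rfl | ⟨k, rfl⟩ : n = 1 ∨ n = 2 ∨ ∃ k, n = k + 3 := by
    rcases n with _ | _ | _ | k
    · omega
    · simp
    · simp
    · exact Or.inr (Or.inr ⟨k, rfl⟩)
  · simpa using e1
  · exact e2
  · have h := natCast_mul_lCoeff_eq_sum ψ α (k + 3)
    rw [lCoeff_eq_zero ψ α hψ (by omega), mul_zero, Finset.sum_Icc_succ_top (by omega),
      Finset.sum_Icc_succ_top (by omega), Finset.sum_Icc_succ_top (by omega),
      Finset.sum_eq_zero] at h
    · rw [show k + 3 - (k + 2 + 1) = 0 by omega, show k + 3 - (k + 1 + 1) = 1 by omega,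
        show k + 3 - (k + 1) = 2 by omega, hS1, hS2, lCoeff_zero, ih (k + 1) (by omega) (by omega),
        ih (k + 1 + 1) (by omega) (by omega)] at h
      linear_combination -h
    · intro j hj
      rw [Finset.mem_Icc] at hj
      rw [lCoeff_eq_zero ψ α hψ (by omega), mul_zero]

/-- The inverse roots of the `L`-function `1 + K(α) T + S T ^ 2` form a Frobenius pair. -/
theorem exists_isFrobeniusPair {F : Type w} [Field F] [Fintype F] [DecidableEq F]
    {ψ : AddChar F ℂ} (hψ : ψ ≠ 1) (α : F) :
    ∃ x y : ℂ, IsFrobeniusPair ψ α x y ∧ x + y = -kloostermanSum ψ α ∧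
      x * y = if α = 0 then 0 else (Nat.card F : ℂ) := by
  set S : ℂ := if α = 0 then 0 else (Nat.card F : ℂ)
  obtain ⟨x, hx⟩ := IsAlgClosed.exists_root (X ^ 2 + C (kloostermanSum ψ α) * X + C S : ℂ[X]) (by
    rw [degree_eq_natDegree (by
      intro h
      have := natDegree_X_sq_add (kloostermanSum ψ α) S
      rw [h] at this
      simp at this), natDegree_X_sq_add]
    norm_num)
  have hx' : x ^ 2 + kloostermanSum ψ α * x + S = 0 := by simpa using hx
  have hadd : x + (-kloostermanSum ψ α - x) = -kloostermanSum ψ α := by ring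
  have hmul : x * (-kloostermanSum ψ α - x) = S := by linear_combination -hx'
  refine ⟨x, -kloostermanSum ψ α - x, ?_, hadd, hmul⟩
  intro E _ _ _ _
  have : FiniteDimensional F E := Module.Finite.of_finite
  rw [kloostermanSum_extendChar_eq_primeSum,
    primeSum_eq_neg_pow_add_pow hψ hadd hmul _ finrank_pos]

theorem exists_extension (F : Type w) [Field F] [Finite F] {n : ℕ} (hn : n ≠ 0) :
    ∃ (E : Type w) (_ : Field E) (_ : Finite E) (_ : Algebra F E), finrank F E = n := by
  obtain ⟨p, hp⟩ := CharP.exists F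
  have : Fact p.Prime := ⟨CharP.char_is_prime F p⟩
  have : NeZero n := ⟨hn⟩
  refine ⟨ULift.{w} (FiniteField.Extension F p n), inferInstance, inferInstance, inferInstance, ?_⟩
  rw [(ULift.moduleEquiv (R := F) (M := FiniteField.Extension F p n)).finrank_eq,
    FiniteField.finrank_extension]

/-- The first two power sums already determine the elementary symmetric functions of a pair of
Frobenius eigenvalues. -/
theorem IsFrobeniusPair.add_mul_eq {F : Type w} [Field F] [Fintype F] [DecidableEq F]
    {ψ : AddChar F ℂ} (hψ : ψ ≠ 1) {α : F} {x y : ℂ} (h : IsFrobeniusPair ψ α x y) :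
    x + y = -kloostermanSum ψ α ∧ x * y = if α = 0 then 0 else (Nat.card F : ℂ) := by
  obtain ⟨x', y', h', hadd, hmul⟩ := exists_isFrobeniusPair hψ α
  have key (n : ℕ) (hn : n ≠ 0) : x ^ n + y ^ n = x' ^ n + y' ^ n := by
    classical
    obtain ⟨E, _, _, _, hE⟩ := exists_extension F hn
    have h1 := h E
    have h2 := h' E
    rw [hE] at h1 h2
    exact neg_injective (h1.symm.trans h2)
  have k1 := key 1 one_ne_zero
  have k2 := key 2 two_ne_zero
  rw [pow_one, pow_one, pow_one, pow_one] at k1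
  refine ⟨k1.trans hadd, ?_⟩
  rw [← hmul]
  linear_combination (1 / 2 : ℂ) * (x + y + x' + y') * k1 - (1 / 2 : ℂ) * k2

end Extension

/-! ### From endomorphisms to matrices -/

section Matrices

theorem isNilpotent_toLin'_sub {F : Type*} [Field F] {n : ℕ} {a : Matrix (Fin n) (Fin n) F}
    {α : F} (ha : HasUniqueEigenvalue a α) : IsNilpotent (Matrix.toLin' a - algebraMap F _ α) := by
  set K := AlgebraicClosure F
  set f := algebraMap F K with hf
  set A := Matrix.toLin' (a.map f) with hA
  have h2 : IsNilpotent (A - algebraMap K _ (f α)) := by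
    -- Over an algebraically closed field the minimal polynomial of `A` is a power of `X - α`.
    have hroots : ∀ β ∈ (minpoly K A).roots, β = f α := fun β hβ =>
      (ha β).1 (End.hasEigenvalue_of_isRoot (Polynomial.isRoot_of_mem_roots hβ))
    have h1 := (IsAlgClosed.splits (minpoly K A)).eq_prod_roots_of_monic
      (minpoly.monic (Algebra.IsIntegral.isIntegral A))
    rw [Multiset.eq_replicate_card.2 hroots, Multiset.map_replicate, Multiset.prod_replicate] at h1
    refine ⟨(minpoly K A).roots.card, ?_⟩
    have h3 := minpoly.aeval K A
    rwa [h1, map_pow, map_sub, Polynomial.aeval_X, Polynomial.aeval_C] at h3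
  have h3 : A - algebraMap K _ (f α)
      = Matrix.toLinAlgEquiv' (f.mapMatrix (a - algebraMap F _ α)) := by
    have h4 : f.mapMatrix (algebraMap F (Matrix (Fin n) (Fin n) F) α)
        = algebraMap K (Matrix (Fin n) (Fin n) K) (f α) := by
      rw [RingHom.mapMatrix_apply, Matrix.algebraMap_eq_diagonal, Matrix.algebraMap_eq_diagonal,
        Matrix.diagonal_map (map_zero f)]
      rfl
    rw [map_sub, map_sub, h4, AlgEquiv.commutes]
    rfl
  rw [h3, IsNilpotent.map_iff (AlgEquiv.injective _),
    IsNilpotent.map_iff (Matrix.map_injective f.injective)] at h2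
  have h4 := h2.map (Matrix.toLinAlgEquiv' : Matrix (Fin n) (Fin n) F ≃ₐ[F] _)
  rw [map_sub, AlgEquiv.commutes] at h4
  exact h4

theorem matrixKloostermanSum_eq {F : Type*} [Field F] [Fintype F] [DecidableEq F]
    (ψ : AddChar F ℂ) {n : ℕ} (a : Matrix (Fin n) (Fin n) F) (α : F) :
    matrixKloostermanSum ψ a = endKloostermanSum ψ α (Matrix.toLin' a - algebraMap F _ α) := by
  rw [matrixKloostermanSum, endKloostermanSum]
  refine Fintype.sum_equiv (Matrix.GeneralLinearGroup.toLin.trans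
    (LinearMap.GeneralLinearGroup.generalLinearEquiv F (Fin n → F))).toEquiv _ _ fun x => ?_
  congr 1
  rw [kloostermanTrace, ← Matrix.trace_toLin'_eq, map_add, Matrix.toLin'_mul]
  congr 1
  set y := (Matrix.GeneralLinearGroup.toLin.trans
    (LinearMap.GeneralLinearGroup.generalLinearEquiv F (Fin n → F))).toEquiv x
  have h1 : (y : (Fin n → F) →ₗ[F] (Fin n → F)) = Matrix.toLin' x.1 := rfl
  have h2 : (y.symm : (Fin n → F) →ₗ[F] (Fin n → F)) = Matrix.toLin' x⁻¹.1 := rfl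
  rw [h1, h2]
  ext
  simp

theorem map_le_iff_mem_invtSubmodule {F V : Type*} [Field F] [AddCommGroup V] [Module F V]
    (f : End F V) (α : F) (W : Submodule F V) :
    W.map f ≤ W ↔ W ∈ End.invtSubmodule (f - algebraMap F _ α) := by
  rw [Submodule.map_le_iff_le_comap]
  constructor
  · intro h v hv
    exact W.sub_mem (h hv) (W.smul_mem α hv)
  · intro h v hv
    have h1 : f v - α • v ∈ W := h hv
    have h2 := W.add_mem h1 (W.smul_mem α hv)
    rwa [sub_add_cancel] at h2

theorem invariantSubspaceSum_eq_sum_range {F : Type*} [Field F] [Finite F] {n : ℕ}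
    (a : Matrix (Fin n) (Fin n) F) (α : F) (x y : ℂ) :
    invariantSubspaceSum x y (Matrix.toLin' a - algebraMap F _ α)
      = ∑ k ∈ Finset.range (n + 1), (invariantSubspaceCount a k : ℂ) * x ^ k * y ^ (n - k) := by
  classical
  rw [invariantSubspaceSum, ← Finset.sum_filter]
  have h1 (W : Submodule F (Fin n → F)) : finrank F W ∈ Finset.range (n + 1) := by
    have := W.finrank_le
    rw [finrank_fin_fun] at this
    exact Finset.mem_range.2 (by omega)
  rw [← Finset.sum_fiberwise_of_maps_to (g := fun W : Submodule F (Fin n → F) => finrank F W)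
    (t := Finset.range (n + 1)) fun W _ => h1 W]
  refine Finset.sum_congr rfl fun k _ => ?_
  have h2 : invariantSubspaceCount a k
      = (Finset.filter (fun W : Submodule F (Fin n → F) => finrank F W = k)
        {W | W ∈ End.invtSubmodule (Matrix.toLin' a - algebraMap F _ α)}).card := by
    rw [invariantSubspaceCount, Nat.card_eq_fintype_card, Fintype.card_subtype,
      Finset.filter_filter]
    simp only [map_le_iff_mem_invtSubmodule _ α, and_comm]
  rw [Finset.sum_congr rfl (g := fun _ => x ^ k * y ^ (n - k)), Finset.sum_const, h2,
    nsmul_eq_mul, mul_assoc]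
  intro W hW
  rw [(Finset.mem_filter.1 hW).2, finrank_fin_fun]

/-- For `α ≠ 0` the endomorphism `a` is injective, hence maps each of its invariant subspaces onto
itself. -/
theorem stableSubspaceCount_eq {F : Type*} [Field F] {n : ℕ} {a : Matrix (Fin n) (Fin n) F} {α : F}
    (ha : HasUniqueEigenvalue a α) (hα : α ≠ 0) (k : ℕ) :
    stableSubspaceCount a k = invariantSubspaceCount a k := by
  have hinj : Function.Injective (Matrix.toLin' a) := by
    rw [← LinearMap.ker_eq_bot, LinearMap.ker_eq_bot']
    intro v hv
    obtain ⟨m, hm⟩ := isNilpotent_toLin'_sub ha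
    have h1 (m : ℕ) : ((Matrix.toLin' a - algebraMap F _ α) ^ m) v = (-α) ^ m • v := by
      induction m with
      | zero => simp
      | succ m ih =>
        rw [pow_succ', End.mul_apply, ih, LinearMap.sub_apply, map_smul, hv,
          Module.algebraMap_end_apply, smul_zero, zero_sub, smul_smul, ← neg_smul, pow_succ']
        ring_nf
    have h2 := h1 m
    rw [hm, LinearMap.zero_apply] at h2
    exact (smul_eq_zero.1 h2.symm).resolve_left (pow_ne_zero _ (neg_ne_zero.2 hα))
  rw [stableSubspaceCount, invariantSubspaceCount]
  refine Nat.card_congr (Equiv.subtypeEquivRight fun W => and_congr_right fun _ => ⟨le_of_eq, ?_⟩)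
  intro h
  exact Submodule.eq_of_le_of_finrank_eq h (Submodule.equivMapOfInjective _ hinj W).finrank_eq.symm

end Matrices

end MatrixKloosterman

open MatrixKloosterman in
theorem theorem3 {F : Type u} [Field F] [Fintype F] [DecidableEq F]
    (ψ : AddChar F ℂ) (hψ : ψ ≠ 1) (n : ℕ) (a : Matrix (Fin n) (Fin n) F) (α : F)
    (ha : HasUniqueEigenvalue a α) :
    (∃ l₁ l₂ : ℂ, IsFrobeniusPair ψ α l₁ l₂) ∧
    ∀ l₁ l₂ : ℂ, IsFrobeniusPair ψ α l₁ l₂ →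
      matrixKloostermanSum ψ a
        = (-1) ^ n * (Fintype.card F : ℂ) ^ (n * (n - 1) / 2)
          * ∑ k ∈ Finset.range (n + 1),
              (invariantSubspaceCount a k : ℂ) * l₁ ^ k * l₂ ^ (n - k) ∧
      (α ≠ 0 →
        matrixKloostermanSum ψ a
          = (-1) ^ n * (Fintype.card F : ℂ) ^ (n * (n - 1) / 2)
            * ∑ k ∈ Finset.range (n + 1),
                (stableSubspaceCount a k : ℂ) * l₁ ^ k * l₂ ^ (n - k)) := by
  refine ⟨?_, fun l₁ l₂ h => ?_⟩
  · obtain ⟨x, y, h, -⟩ := exists_isFrobeniusPair hψ α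
    exact ⟨x, y, h⟩
  · have hmain : matrixKloostermanSum ψ a
        = (-1) ^ n * (Fintype.card F : ℂ) ^ (n * (n - 1) / 2)
          * ∑ k ∈ Finset.range (n + 1),
              (invariantSubspaceCount a k : ℂ) * l₁ ^ k * l₂ ^ (n - k) := by
      obtain ⟨hadd, hmul⟩ := h.add_mul_eq hψ
      rw [matrixKloostermanSum_eq ψ a α, ← invariantSubspaceSum_eq_sum_range a α,
        ← Nat.card_eq_fintype_card]
      exact endKloostermanSum_eq_invariantSubspaceSum hψ hadd hmul n
        (Module.finrank_fin_fun F)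
        (isNilpotent_toLin'_sub ha)
    refine ⟨hmain, fun hα => ?_⟩
    simp only [stableSubspaceCount_eq ha hα]
    exact hmain
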